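/- Let $k,m,d_{\max}$ be non-negative integers with $d_{\max}\le k$ and let $\Omega=(\Omega_1,\dots,\Omega_{d_{\max}})$ be a probability distribution on $\{1,\dots,d_{\max}\}$. Consider the random bipartite graph of an LT code with $k$ input symbols and $m$ output symbols: independently, each output symbol draws a degree $d$ with probability $\Omega_d$ and is then joined to a uniformly random set of $d$ input symbols. Triangularization with random inactivations starts with all $k$ input symbols active. The reduced degree of an output symbol is the number of its active neighbours; the ripple is the set of output symbols of reduced degree $1$, and the cloud is the set of output symbols of reduced degree at least $2$. At the step from $u$ to $u-1$ active input symbols ($u=k,k-1,\dots,1$): if the ripple is not empty, an output symbol in it is chosen uniformly at random and its unique active neighbour is marked resolvable (no longer active); if the ripple is empty, a uniformly random active input symbol is marked inactive (no longer active; an inactivation). Let $\mathscr C_u,\mathscr R_u$ be the cloud and the ripple when $u$ input symbols are active, let $\mathsf C_u=|\mathscr C_u|$ and $\mathsf R_u=|\mathscr R_u|$, let $\mathsf N_u$ be the number of inactive input symbols at that stage, and put $\mathsf S_u=(\mathsf C_u,\mathsf R_u,\mathsf N_u)$. Let $\mathsf N$ be the total number of inactivations, i.e. the number of $u\in\{1,\dots,k\}$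 with $\mathscr R_u=\emptyset$, and let $f_{\mathsf N}(n)=\Pr\{\mathsf N=n\}$. For $1\le u\le k$ define $$p_u=\frac{\displaystyle\sum_{d=2}^{d_{\max}}\Omega_d\,\frac dk\,(d-1)\,\frac{u-1}{k-1}\,\frac{\binom{k-u}{d-2}}{\binom{k-2}{d-2}}}{\displaystyle 1-\sum_{d=1}^{d_{\max}}\Omega_d\left[u\,\frac{\binom{k-u}{d-1}}{\binom kd}+\frac{\binom{k-u}{d}}{\binom kd}\right]},$$ with $p_u=0$ if the denominator is $0$ (the cloud is then almost surely empty). Then: 1. For $1\le u\le k$ and every output symbol $i$ with $\Pr\{i\in\mathscr C_u\}>0$, $\Pr\{i\in\mathscr R_{u-1}\mid i\in\mathscr C_u\}=p_u$. 2. (Initial condition) $\Pr\{\mathsf S_k=(c,r,n)\}=\binom mr\Omega_1^{r}(1-\Omega_1)^{c}$ if $c+r=m$ and $n=0$, and it is $0$ for all other $c,r,n\ge 0$. 3. (Transitions) Let $1\le u\le k$ and $\Pr\{\mathsf S_u=(c,r,n)\}>0$. If $r>0$, then for $0\le b\le c$ and $1\le a\le r$ $$\Pr\{\mathsf S_{u-1}=(c-b,\,r-a+b,\,n)\mid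 \mathsf S_u=(c,r,n)\}=\binom cb p_u^{b}(1-p_u)^{c-b}\binom{r-1}{a-1}\Big(\frac1u\Big)^{a-1}\Big(1-\frac1u\Big)^{r-a}.$$ If $r=0$, then for $0\le b\le c$ $$\Pr\{\mathsf S_{u-1}=(c-b,\,b,\,n+1)\mid \mathsf S_u=(c,0,n)\}=\binom cb p_u^{b}(1-p_u)^{c-b}.$$ All other transitions have probability $0$. In particular the number of inactivations rises by one if the ripple is empty and stays the same otherwise. 4. (Recursion) Let $T_u(s,s')$ denote the transition probability from $s$ to $s'$ given by the formulas of item 3, for every state $s=(c,r,n)$. For $1\le u\le k$ and every $s'$, $$\Pr\{\mathsf S_{u-1}=s'\}=\sum_{c=0}^{m}\sum_{r=0}^{m}\sum_{n=0}^{k}\Pr\{\mathsf S_u=(c,r,n)\}\,T_u((c,r,n),s').$$ 5. (Law of the number of inactivations) For every $n\ge 0$, $$f_{\mathsf N}(n)=\sum_{c_0=0}^{m}\sum_{r_0=0}^{m}\Pr\{\mathsf S_0=(c_0,r_0,n)\}.$$ -/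

import Mathlib

namespace LTCode

/-- The law of the neighbourhood of one output symbol of an LT code with `k` input symbols: draw a
degree `d` from `Ω`, then draw a uniformly random set of `d` input symbols.  (The `else` branch,
`d > k`, has probability `0` as soon as `Ω` lives on degrees at most `k`.) -/
noncomputable def neighborhoodLaw (Ω : PMF ℕ) (k : ℕ) : PMF (Finset (Fin k)) :=
  Ω.bind fun d =>
    if h : (Finset.powersetCard d (Finset.univ : Finset (Fin k))).Nonempty then
      PMF.uniformOfFinset _ h
    else PMF.pure ∅

/-- The law of `m` independent samples of a law on a finite type. -/
noncomputable def iidLaw {α : Type*} [Fintype α] (p : PMF α) (m : ℕ) : PMF (Fin m → α) :=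
  PMF.ofFintype (fun g => ∏ i, p (g i)) (by
    classical
    have h : ∑ a, p a = 1 := by
      rw [← tsum_fintype (L := .unconditional _)]; exact p.tsum_coe
    have h2 := Finset.prod_univ_sum (fun _ : Fin m => (Finset.univ : Finset α)) (fun _ a => p a)
    rw [Fintype.piFinset_univ] at h2
    rw [← h2]
    simp [h])

/-- The law of the random bipartite graph of the code: output symbol `i` has the neighbours `G i`,
and the `m` output symbols are independent. -/
noncomputable def graphLaw (Ω : PMF ℕ) (k m : ℕ) : PMF (Fin m → Finset (Fin k)) :=
  iidLaw (neighborhoodLaw Ω k) m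

/-- The marks of the input symbols during triangularization: the active and the inactive ones; all
others are resolvable.  The reduced graph is the subgraph on the active input symbols. -/
structure Marks (k : ℕ) where
  active : Finset (Fin k)
  inactive : Finset (Fin k)

/-- Output symbols of reduced degree `1`. -/
def ripple {k m : ℕ} (G : Fin m → Finset (Fin k)) (A : Finset (Fin k)) : Finset (Fin m) :=
  Finset.univ.filter fun i => (G i ∩ A).card = 1

/-- Output symbols of reduced degree at least `2`. -/
def cloud {k m : ℕ} (G : Fin m → Finset (Fin k)) (A : Finset (Fin k)) : Finset (Fin m) :=
  Finset.univ.filter fun i => 2 ≤ (G i ∩ A).card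

/-- One step of triangularization with random inactivations.  If the ripple is not empty, a uniformly
random output symbol of the ripple is selected and its only active neighbour becomes resolvable.
If the ripple is empty, a uniformly random active input symbol becomes inactive.
(With no active symbol left, nothing happens.) -/
noncomputable def step {k m : ℕ} (G : Fin m → Finset (Fin k)) (x : Marks k) : PMF (Marks k) :=
  if h : (ripple G x.active).Nonempty then
    (PMF.uniformOfFinset (ripple G x.active) h).map fun i => ⟨x.active \ G i, x.inactive⟩
  else if h' : x.active.Nonempty then
    (PMF.uniformOfFinset x.active h').map fun v => ⟨x.active.erase v, insert v x.inactive⟩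
  else PMF.pure x

/-- The history of the first `t` steps of triangularization of the graph `G`.  Histories are indexed
by the number `u` of active input symbols: the start has index `k`, and step number `t + 1` leads
from index `k - t` to index `k - (t + 1)`. -/
noncomputable def history {k m : ℕ} (G : Fin m → Finset (Fin k)) : ℕ → PMF (ℕ → Marks k)
  | 0 => PMF.pure fun _ => ⟨Finset.univ, ∅⟩
  | t + 1 => (history G t).bind fun x =>
      (step G (x (k - t))).map fun y => Function.update x (k - (t + 1)) y

/-- An outcome of the experiment: the graph, and the marks at each stage `u = k, k - 1, …, 0`. -/
structure Run (k m : ℕ) where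
  graph : Fin m → Finset (Fin k)
  marks : ℕ → Marks k

instance (k m : ℕ) : MeasurableSpace (Run k m) := ⊤

/-- The probability measure of the experiment: draw the graph and triangularize it in `k` steps. -/
noncomputable def Pr (Ω : PMF ℕ) (k m : ℕ) : MeasureTheory.Measure (Run k m) :=
  ((graphLaw Ω k m).bind fun G => (history G k).map fun x => Run.mk G x).toMeasure

/-- The ripple when `u` input symbols are active. -/
def rippleAt {k m : ℕ} (u : ℕ) (ω : Run k m) : Finset (Fin m) := ripple ω.graph (ω.marks u).active

/-- The cloud when `u` input symbols are active. -/
def cloudAt {k m : ℕ} (u : ℕ) (ω : Run k m) : Finset (Fin m) := cloud ω.graph (ω.marks u).active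

/-- The decoder state: the sizes of the cloud and of the ripple and the number of inactive
input symbols, when `u` input symbols are active. -/
def S {k m : ℕ} (u : ℕ) (ω : Run k m) : ℕ × ℕ × ℕ :=
  ((cloudAt u ω).card, (rippleAt u ω).card, (ω.marks u).inactive.card)

/-- The total number of inactivations: the number of steps that find the ripple empty. -/
def N {k m : ℕ} (ω : Run k m) : ℕ :=
  ((Finset.Icc 1 k).filter fun u => rippleAt u ω = ∅).card

/-- The probability that an output symbol is in the cloud at stage `u` and in the ripple at
stage `u - 1`. -/
noncomputable def cloudToRippleProb (Ω : PMF ℕ) (k dmax u : ℕ) : ℝ :=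
  ∑ d ∈ Finset.Icc 2 dmax, (Ω d).toReal * ((d : ℝ) / k) * ((d : ℝ) - 1) *
    (((u : ℝ) - 1) / ((k : ℝ) - 1)) *
    (((k - u).choose (d - 2) : ℝ) / ((k - 2).choose (d - 2) : ℝ))

/-- The probability that an output symbol is in the cloud at stage `u`. -/
noncomputable def cloudProb (Ω : PMF ℕ) (k dmax u : ℕ) : ℝ :=
  1 - ∑ d ∈ Finset.Icc 1 dmax, (Ω d).toReal *
    ((u : ℝ) * ((k - u).choose (d - 1) : ℝ) / (k.choose d : ℝ) +
      ((k - u).choose d : ℝ) / (k.choose d : ℝ))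

/-- The probability `p_u` that a cloud symbol enters the ripple. -/
noncomputable def leaveProb (Ω : PMF ℕ) (k dmax u : ℕ) : ℝ :=
  cloudToRippleProb Ω k dmax u / cloudProb Ω k dmax u

/-- The transition probability from `s = (c, r, n)` at stage `u` to `s'` at stage `u - 1`, where `p`
stands for `p_u`: `b` symbols leave the cloud for the ripple, `a` symbols leave the ripple. -/
noncomputable def transProb (p : ℝ) (u : ℕ) : ℕ × ℕ × ℕ → ℕ × ℕ × ℕ → ℝ
  | (c, r, n), s' =>
    if 0 < r then
      ∑ b ∈ Finset.range (c + 1), ∑ a ∈ Finset.Icc 1 r,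
        if s' = (c - b, r - a + b, n) then
          (c.choose b : ℝ) * p ^ b * (1 - p) ^ (c - b) *
            ((r - 1).choose (a - 1) : ℝ) * (1 / (u : ℝ)) ^ (a - 1) * (1 - 1 / (u : ℝ)) ^ (r - a)
        else 0
    else
      ∑ b ∈ Finset.range (c + 1),
        if s' = (c - b, b, n + 1) then (c.choose b : ℝ) * p ^ b * (1 - p) ^ (c - b) else 0

end LTCode

/-!
The proof rests on deferred decisions: the course of the triangularization down to the active set
`A` reveals very little about the neighbourhoods of the output symbols that still matter.  Write
`symbolType A S` for what is revealed of a neighbourhood `S`: nothing beyond the bare fact when `S`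
has at least two elements in `A`, and otherwise `S \ A` together with the size of `S ∩ A`.  For a
fixed graph, the probability of reaching given marks with active set `A` depends on the graph only
through these types (`chain_eq_of_symbolType`): a symbol of the cloud has been in the cloud all
along, and a selected ripple symbol lost its last active neighbour, so that the identity of the
remaining active neighbour of a ripple symbol has never been used.

Since the neighbourhoods are independent, they may be resampled within their types
(`sum_prod_mul_prod_of_fiber`).  Hence, conditionally on the marks, the cloud and the ripple, and
for each active symbol `v`, every cloud symbol drops to reduced degree one on removal of `v`
independently with probability `leaveProb` (`sum_symbolType_cloud`), and every ripple symbol is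
attached to `v` independently with probability `1 / u` (`sum_symbolType_ripple`).

With an empty ripple, `v` is uniform.  With a ripple `R`, the symbol `v` is removed with probability
`D.card / R.card`, where `D` is the set of ripple symbols attached to `v`; summing over the `u`
values of `v` gives the weight of `D` in `kernelExpect`, and the identity
`choose r a * (a / r) = choose (r - 1) (a - 1)` turns it into the transition probabilities
(`sum_powerset_ripple`).  As this kernel depends on the cloud and the ripple only, it passes to the
conditional probabilities (`Pr_real_and_eq_mul`).  The initial law is a product computation, and the
number of inactivations is almost surely the number of inactive symbols at stage `0`
(`mem_support_history`).
-/

namespace LTCode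

open Finset

variable {k m : ℕ}

/-! ### Expectations over finite types -/

/-- The expectation of a real function under a law on a finite type. -/
noncomputable def expect {α : Type*} [Fintype α] (p : PMF α) (f : α → ℝ) : ℝ :=
  ∑ a, (p a).toReal * f a

section expect

variable {α β : Type*} [Fintype α] [Fintype β]

lemma expect_pure (a : α) (f : α → ℝ) : expect (PMF.pure a) f = f a := by
  classical
  simp [expect, PMF.pure_apply, apply_ite ENNReal.toReal]

lemma expect_const (p : PMF α) (c : ℝ) : expect p (fun _ => c) = c := by
  rw [expect, ← sum_mul, ← ENNReal.toReal_sum fun _ _ => p.apply_ne_top _,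
    ← tsum_fintype (L := .unconditional _), PMF.tsum_coe, ENNReal.toReal_one, one_mul]

lemma expect_bind (p : PMF α) (q : α → PMF β) (f : β → ℝ) :
    expect (p.bind q) f = expect p fun a => expect (q a) f := by
  classical
  unfold expect
  have h : ∀ b, ((p.bind q) b).toReal = ∑ a, (p a).toReal * (q a b).toReal := by
    intro b
    rw [PMF.bind_apply, tsum_fintype, ENNReal.toReal_sum
      (fun a _ => ENNReal.mul_ne_top (p.apply_ne_top a) ((q a).apply_ne_top b))]
    simp
  simp_rw [h, sum_mul, mul_sum]
  rw [sum_comm]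
  simp [mul_assoc]

lemma expect_map (p : PMF α) (g : α → β) (f : β → ℝ) :
    expect (p.map g) f = expect p fun a => f (g a) := by
  rw [← PMF.bind_pure_comp, expect_bind]
  simp [expect_pure]

lemma expect_uniformOfFinset [DecidableEq α] (s : Finset α) (hs : s.Nonempty) (f : α → ℝ) :
    expect (PMF.uniformOfFinset s hs) f = ∑ a ∈ s, 1 / (s.card : ℝ) * f a := by
  unfold expect
  simp_rw [PMF.uniformOfFinset_apply, apply_ite ENNReal.toReal, ite_mul, ENNReal.toReal_zero, zero_mul]
  rw [← sum_filter]
  simp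

lemma expect_congr_of_ne_zero (p : PMF α) {f g : α → ℝ} (h : ∀ a, p a ≠ 0 → f a = g a) :
    expect p f = expect p g := by
  refine sum_congr rfl fun a _ => ?_
  by_cases ha : p a = 0
  · simp [ha]
  · rw [h a ha]

lemma expect_indicator (p : PMF α) [MeasurableSpace α] [DiscreteMeasurableSpace α] (Q : α → Prop)
    [DecidablePred Q] :
    p.toMeasure.real {a | Q a} = expect p fun a => if Q a then 1 else 0 := by
  classical
  rw [MeasureTheory.measureReal_def, PMF.toMeasure_apply_fintype, ENNReal.toReal_sum]
  · refine sum_congr rfl fun a _ => ?_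
    by_cases h : Q a <;> simp [h]
  · intro a _
    by_cases h : Q a <;> simp [h, p.apply_ne_top]

end expect

/-! ### The Markov chain of marks for a fixed graph -/

/-- Marks are pairs of sets of input symbols. -/
def marksEquiv (k : ℕ) : Marks k ≃ Finset (Fin k) × Finset (Fin k) where
  toFun x := (x.active, x.inactive)
  invFun p := ⟨p.1, p.2⟩
  left_inv _ := rfl
  right_inv _ := rfl

instance (k : ℕ) : Fintype (Marks k) := Fintype.ofEquiv _ (marksEquiv k).symm

instance (k : ℕ) : DecidableEq (Marks k) := (marksEquiv k).decidableEq

/-- The law of the marks after `t` steps of triangularization of the graph `G`. -/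
noncomputable def chain (G : Fin m → Finset (Fin k)) : ℕ → PMF (Marks k)
  | 0 => PMF.pure ⟨univ, ∅⟩
  | t + 1 => (chain G t).bind (step G)

lemma map_history_last (G : Fin m → Finset (Fin k)) (t : ℕ) :
    (history G t).map (fun x => x (k - t)) = chain G t := by
  induction t with
  | zero => simp [history, chain, PMF.pure_map]
  | succ t ih =>
    rw [history, chain, ← ih, PMF.map_bind, PMF.bind_map]
    congr 1
    funext x
    rw [PMF.map_comp]
    simp only [Function.comp_def, Function.update_self]
    exact PMF.map_id _

lemma map_history_last_two (G : Fin m → Finset (Fin k)) {t : ℕ} (ht : t < k) :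
    (history G (t + 1)).map (fun x => (x (k - t), x (k - (t + 1)))) =
      (chain G t).bind fun x => (step G x).map fun y => (x, y) := by
  rw [history, ← map_history_last, PMF.map_bind, PMF.bind_map]
  congr 1
  funext x
  rw [PMF.map_comp]
  simp only [Function.comp_def]
  have : k - t ≠ k - (t + 1) := by omega
  simp [Function.update_of_ne this]

/-- Later steps do not change the part of the history that is already written. -/
lemma map_history_of_le {β : Type*} (G : Fin m → Finset (Fin k)) {t s : ℕ} (hts : t ≤ s)
    (hs : s ≤ k) (f : (ℕ → Marks k) → β)
    (hf : ∀ x j y, j < k - t → f (Function.update x j y) = f x) :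
    (history G s).map f = (history G t).map f := by
  induction s, hts using Nat.le_induction with
  | base => rfl
  | succ s hts ih =>
    rw [← ih (by omega), history, PMF.map_bind]
    have : ∀ x, ((step G (x (k - s))).map fun y => Function.update x (k - (s + 1)) y).map f =
        PMF.pure (f x) := by
      intro x
      rw [PMF.map_comp]
      have : (f ∘ fun y => Function.update x (k - (s + 1)) y) = Function.const _ (f x) := by
        funext y
        exact hf x _ y (by omega)
      rw [this, PMF.map_const]
    simp_rw [this]
    rfl

/-- The law of a run, restricted to the graph and the marks at two consecutive stages. -/
lemma Pr_real_eq_expect (Ω : PMF ℕ) {u : ℕ} (hu : 1 ≤ u) (huk : u ≤ k)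
    (Q : (Fin m → Finset (Fin k)) → Marks k → Marks k → Prop)
    [∀ G x y, Decidable (Q G x y)] :
    (Pr Ω k m).real {ω | Q ω.graph (ω.marks u) (ω.marks (u - 1))} =
      expect (graphLaw Ω k m) fun G => expect (chain G (k - u)) fun x =>
        expect (step G x) fun y => if Q G x y then 1 else 0 := by
  let _ : MeasurableSpace ((Fin m → Finset (Fin k)) × Marks k × Marks k) := ⊤
  have h1 : ∀ G : Fin m → Finset (Fin k), (history G k).map (fun x => (x u, x (u - 1))) =
      (chain G (k - u)).bind fun x => (step G x).map fun y => (x, y) := by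
    intro G
    rw [← map_history_last_two G (by omega : k - u < k),
      map_history_of_le (t := k - u + 1) G (by omega) le_rfl]
    · have e1 : k - (k - u) = u := by omega
      have e2 : k - (k - u + 1) = u - 1 := by omega
      rw [e1, e2]
    · intro x j y hj
      rw [Function.update_of_ne (by omega), Function.update_of_ne (by omega)]
  set p := (graphLaw Ω k m).bind fun G => (history G k).map fun x => Run.mk G x with hp
  have h2 : p.map (fun ω => (ω.graph, ω.marks u, ω.marks (u - 1))) =
      (graphLaw Ω k m).bind fun G => (chain G (k - u)).bind fun x =>
        (step G x).map fun y => (G, x, y) := by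
    rw [hp, PMF.map_bind]
    congr 1
    funext G
    have := congrArg (fun q => q.map (fun z => (G, z))) (h1 G)
    simp only [PMF.map_comp, PMF.map_bind, Function.comp_def] at this ⊢
    exact this
  have h3 : (Pr Ω k m).real {ω | Q ω.graph (ω.marks u) (ω.marks (u - 1))} =
      (p.map (fun ω => (ω.graph, ω.marks u, ω.marks (u - 1)))).toMeasure.real
        {z | Q z.1 z.2.1 z.2.2} := by
    rw [MeasureTheory.measureReal_def, MeasureTheory.measureReal_def,
      PMF.toMeasure_map_apply _ _ _ (fun _ _ => MeasurableSpace.measurableSet_top)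
        MeasurableSpace.measurableSet_top]
    rfl
  rw [h3, h2, expect_indicator, expect_bind]
  simp only [expect_bind, expect_map]

/-! ### One step of triangularization -/

lemma disjoint_cloud_ripple (G : Fin m → Finset (Fin k)) (A : Finset (Fin k)) :
    Disjoint (cloud G A) (ripple G A) := by
  rw [Finset.disjoint_left]
  intro i hi hi'
  simp only [cloud, ripple, mem_filter, mem_univ, true_and] at hi hi'
  omega

lemma sdiff_eq_erase_of_inter_card_eq_one {α : Type*} [DecidableEq α] {A S : Finset α}
    (h : (S ∩ A).card = 1) {v : α} (hv : v ∈ A) (hvS : v ∈ S) : A \ S = A.erase v := by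
  obtain ⟨w, hw⟩ := card_eq_one.1 h
  have hvw : v = w := by
    have : v ∈ S ∩ A := mem_inter.2 ⟨hvS, hv⟩
    rwa [hw, mem_singleton] at this
  subst hvw
  ext a
  have : a ∈ S ∩ A ↔ a = v := by rw [hw, mem_singleton]
  rw [mem_inter] at this
  simp only [mem_sdiff, mem_erase]
  tauto

/-- A step out of a stage with an active symbol removes one active symbol `v`.  With a nonempty
ripple, the weight of `v` is the share of ripple symbols whose active neighbour is `v`; with an
empty ripple, `v` is uniform. -/
lemma expect_step (G : Fin m → Finset (Fin k)) (x : Marks k) (hx : x.active.Nonempty)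
    (f : Marks k → ℝ) :
    expect (step G x) f =
      if (ripple G x.active).Nonempty then
        ∑ v ∈ x.active, (((ripple G x.active).filter fun i => v ∈ G i).card : ℝ) /
          (ripple G x.active).card * f ⟨x.active.erase v, x.inactive⟩
      else ∑ v ∈ x.active, 1 / (x.active.card : ℝ) *
        f ⟨x.active.erase v, insert v x.inactive⟩ := by
  unfold step
  split_ifs with h
  · rw [expect_map, expect_uniformOfFinset]
    simp_rw [card_filter, Nat.cast_sum, sum_div, sum_mul]
    rw [sum_comm]
    refine sum_congr rfl fun i hi => ?_
    have hi1 : (G i ∩ x.active).card = 1 := by simpa [ripple] using hi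
    obtain ⟨v, hv⟩ := card_eq_one.1 hi1
    have hvm : v ∈ G i ∧ v ∈ x.active := by
      rw [← mem_inter, hv]; exact mem_singleton_self v
    rw [sum_eq_single_of_mem v hvm.2]
    · rw [sdiff_eq_erase_of_inter_card_eq_one hi1 hvm.2 hvm.1]
      simp [hvm.1]
    · intro w hw hne
      have : w ∉ G i := fun hwG => hne <| by
        have : w ∈ G i ∩ x.active := mem_inter.2 ⟨hwG, hw⟩
        rwa [hv, mem_singleton] at this
      simp [this]
  · rw [expect_map, expect_uniformOfFinset]

lemma expect_ite_eq {α : Type*} [Fintype α] [DecidableEq α] (p : PMF α) (a : α) :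
    (expect p fun b => if b = a then 1 else 0) = (p a).toReal := by
  simp [expect]

lemma marks_of_step_ne_zero (G : Fin m → Finset (Fin k)) (x y : Marks k) (hx : x.active.Nonempty)
    (h : step G x y ≠ 0) :
    (∃ v ∈ x.active, y.active = x.active.erase v) ∧
      ((ripple G x.active).Nonempty → y.inactive = x.inactive) ∧
      (¬ (ripple G x.active).Nonempty →
        ∃ v ∈ x.active, y = ⟨x.active.erase v, insert v x.inactive⟩) := by
  have h1 : (step G x y).toReal ≠ 0 := by
    simp [ENNReal.toReal_eq_zero_iff, h, (step G x).apply_ne_top y]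
  rw [← expect_ite_eq, expect_step G x hx] at h1
  split_ifs at h1 with hr
  · obtain ⟨v, hv, hne⟩ := exists_ne_zero_of_sum_ne_zero h1
    have : (⟨x.active.erase v, x.inactive⟩ : Marks k) = y := by
      by_contra hc
      simp [hc] at hne
    subst this
    exact ⟨⟨v, hv, rfl⟩, fun _ => rfl, fun h => absurd hr h⟩
  · obtain ⟨v, hv, hne⟩ := exists_ne_zero_of_sum_ne_zero h1
    have : (⟨x.active.erase v, insert v x.inactive⟩ : Marks k) = y := by
      by_contra hc
      simp [hc] at hne
    subst this
    exact ⟨⟨v, hv, rfl⟩, fun h => absurd h hr, fun _ => ⟨v, hv, rfl⟩⟩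

/-- Along a history of positive probability, the stage index counts the active symbols, and the
inactive symbols are counted by the stages with an empty ripple. -/
lemma mem_support_history (G : Fin m → Finset (Fin k)) {t : ℕ} (ht : t ≤ k) (x : ℕ → Marks k)
    (h : x ∈ (history G t).support) :
    (x (k - t)).active.card = k - t ∧ Disjoint (x (k - t)).active (x (k - t)).inactive ∧
      ((Icc (k - t + 1) k).filter fun u => ripple G (x u).active = ∅).card =
        (x (k - t)).inactive.card := by
  induction t generalizing x with
  | zero =>
    simp only [history, PMF.support_pure, Set.mem_singleton_iff] at h
    subst h
    simp
  | succ t ih =>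
    simp only [history, PMF.mem_support_bind_iff, PMF.mem_support_map_iff] at h
    obtain ⟨z, hz, y, hy, rfl⟩ := h
    obtain ⟨h1, h2, h3⟩ := ih (by omega) z hz
    have hne : (z (k - t)).active.Nonempty := by
      rw [← card_pos, h1]; omega
    obtain ⟨⟨v, hv, hya⟩, hr, hr'⟩ := marks_of_step_ne_zero G _ y hne hy
    have hcount : ((Icc (k - (t + 1) + 1) k).filter fun u =>
          ripple G (Function.update z (k - (t + 1)) y u).active = ∅) =
        (insert (k - t) (Icc (k - t + 1) k)).filter fun u => ripple G (z u).active = ∅ := by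
      have : insert (k - t) (Icc (k - t + 1) k) = Icc (k - (t + 1) + 1) k := by
        ext j; simp only [mem_insert, mem_Icc]; omega
      rw [this]
      refine filter_congr fun j hj => ?_
      rw [mem_Icc] at hj
      rw [Function.update_of_ne (by omega)]
    rw [hcount, filter_insert, Function.update_self]
    refine ⟨?_, ?_, ?_⟩
    · rw [hya, card_erase_of_mem hv, h1]; omega
    · by_cases hR : (ripple G (z (k - t)).active).Nonempty
      · rw [hr hR, hya]
        exact disjoint_of_subset_left (erase_subset _ _) h2
      · obtain ⟨w, hw, rfl⟩ := hr' hR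
        rw [disjoint_insert_right]
        exact ⟨notMem_erase _ _, disjoint_of_subset_left (erase_subset _ _) h2⟩
    · by_cases hR : (ripple G (z (k - t)).active).Nonempty
      · rw [if_neg hR.ne_empty, h3, hr hR]
      · obtain ⟨w, hw, rfl⟩ := hr' hR
        rw [if_pos (not_nonempty_iff_eq_empty.1 hR), card_insert_of_notMem (by simp), h3,
          card_insert_of_notMem (disjoint_left.1 h2 hw)]

lemma card_active_of_chain_ne_zero (G : Fin m → Finset (Fin k)) {t : ℕ} (ht : t ≤ k) (x : Marks k)
    (h : chain G t x ≠ 0) : x.active.card = k - t ∧ Disjoint x.active x.inactive := by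
  rw [← map_history_last, ← PMF.mem_support_iff, PMF.mem_support_map_iff] at h
  obtain ⟨z, hz, rfl⟩ := h
  exact ⟨(mem_support_history G ht z hz).1, (mem_support_history G ht z hz).2.1⟩

/-! ### The marks and the type of an output symbol -/

/-- What a set `S` of neighbours reveals when the set of active symbols has shrunk to `A`: a set
with at least two active neighbours reveals nothing else; otherwise the nonactive neighbours and
the number of active ones are known. -/
def symbolType (A S : Finset (Fin k)) : Finset (Fin k) × ℕ :=
  if 2 ≤ (S ∩ A).card then (∅, 2) else (S \ A, (S ∩ A).card)

lemma symbolType_eq_iff {A S S' : Finset (Fin k)} :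
    symbolType A S = symbolType A S' ↔
      (2 ≤ (S ∩ A).card ∧ 2 ≤ (S' ∩ A).card) ∨
        (S \ A = S' \ A ∧ (S ∩ A).card = (S' ∩ A).card ∧ (S ∩ A).card ≤ 1) := by
  unfold symbolType
  split_ifs with h h' h'
  · simp [h, h']
  · simp only [Prod.mk.injEq]
    constructor
    · rintro ⟨-, h2⟩; omega
    · rintro (h2 | h2) <;> omega
  · simp only [Prod.mk.injEq]
    constructor
    · rintro ⟨-, h2⟩; omega
    · rintro (h2 | h2) <;> omega
  · simp only [Prod.mk.injEq]
    constructor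
    · rintro ⟨h1, h2⟩; exact Or.inr ⟨h1, h2, by omega⟩
    · rintro (h2 | h2)
      · omega
      · exact ⟨h2.1, h2.2.1⟩

/-- Less is revealed while more symbols are active. -/
lemma symbolType_eq_of_subset {A B S S' : Finset (Fin k)} (hAB : A ⊆ B)
    (h : symbolType A S = symbolType A S') : symbolType B S = symbolType B S' := by
  rw [symbolType_eq_iff] at h ⊢
  rcases h with ⟨h1, h2⟩ | ⟨h1, h2, h3⟩
  · exact Or.inl ⟨h1.trans (card_le_card (inter_subset_inter_left hAB)),
      h2.trans (card_le_card (inter_subset_inter_left hAB))⟩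
  · have hs : ∀ T : Finset (Fin k), (T ∩ B).card = (T ∩ A).card + ((T \ A) ∩ B).card := by
      intro T
      rw [← card_union_of_disjoint]
      · congr 1
        ext a
        have := @hAB a
        simp only [mem_inter, mem_union, mem_sdiff]
        tauto
      · rw [Finset.disjoint_left]
        intro a
        simp only [mem_inter, mem_sdiff]
        tauto
    have hc : (S ∩ B).card = (S' ∩ B).card := by rw [hs S, hs S', h1, h2]
    have hd : S \ B = S' \ B := by
      have : ∀ T : Finset (Fin k), T \ B = (T \ A) \ B := by
        intro T
        ext a
        have := @hAB a
        simp only [mem_sdiff]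
        tauto
      rw [this S, this S', h1]
    by_cases h4 : 2 ≤ (S ∩ B).card
    · exact Or.inl ⟨h4, hc ▸ h4⟩
    · exact Or.inr ⟨hd, hc, by omega⟩

lemma ripple_eq_of_symbolType {A : Finset (Fin k)} {G G' : Fin m → Finset (Fin k)}
    (h : ∀ i, symbolType A (G i) = symbolType A (G' i)) : ripple G A = ripple G' A := by
  unfold ripple
  refine filter_congr fun i _ => ?_
  have := symbolType_eq_iff.1 (h i)
  omega

lemma cloud_eq_of_symbolType {A : Finset (Fin k)} {G G' : Fin m → Finset (Fin k)}
    (h : ∀ i, symbolType A (G i) = symbolType A (G' i)) : cloud G A = cloud G' A := by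
  unfold cloud
  refine filter_congr fun i _ => ?_
  have := symbolType_eq_iff.1 (h i)
  omega

/-- The probability of reaching the marks `x` depends on the graph only through the types of the
output symbols with respect to the active symbols of `x`. -/
lemma chain_eq_of_symbolType (G G' : Fin m → Finset (Fin k)) {t : ℕ} (ht : t ≤ k) (x : Marks k)
    (h : ∀ i, symbolType x.active (G i) = symbolType x.active (G' i)) :
    chain G t x = chain G' t x := by
  induction t generalizing x with
  | zero => rfl
  | succ t ih =>
    simp only [chain, PMF.bind_apply]
    refine tsum_congr fun z => ?_
    by_cases hcard : z.active.card = k - t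
    swap
    · have h1 : chain G t z = 0 := by
        by_contra hc; exact hcard (card_active_of_chain_ne_zero G (by omega) z hc).1
      have h2 : chain G' t z = 0 := by
        by_contra hc; exact hcard (card_active_of_chain_ne_zero G' (by omega) z hc).1
      rw [h1, h2, zero_mul, zero_mul]
    have hz : z.active.Nonempty := by rw [← card_pos]; omega
    by_cases hsub : ∃ v ∈ z.active, x.active = z.active.erase v
    swap
    · have h1 : step G z x = 0 := by
        by_contra hc; exact hsub (marks_of_step_ne_zero G z x hz hc).1
      have h2 : step G' z x = 0 := by
        by_contra hc; exact hsub (marks_of_step_ne_zero G' z x hz hc).1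
      rw [h1, h2, mul_zero, mul_zero]
    obtain ⟨v, hv, hxv⟩ := hsub
    have hle : x.active ⊆ z.active := hxv ▸ erase_subset _ _
    -- nothing more is revealed at the earlier stage
    have hB : ∀ i, symbolType z.active (G i) = symbolType z.active (G' i) :=
      fun i => symbolType_eq_of_subset hle (h i)
    have hrip := ripple_eq_of_symbolType hB
    rw [ih (by omega) z hB]
    congr 1
    rw [← ENNReal.toReal_eq_toReal_iff' ((step G z).apply_ne_top x) ((step G' z).apply_ne_top x),
      ← expect_ite_eq, ← expect_ite_eq, expect_step G z hz, expect_step G' z hz, hrip]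
    split_ifs with hR
    · refine sum_congr rfl fun w hw => ?_
      by_cases hwx : (⟨z.active.erase w, z.inactive⟩ : Marks k) = x
      swap
      · simp [hwx]
      congr 3
      congr 1
      refine filter_congr fun i hi => ?_
      -- an earlier ripple symbol is never in the later cloud, so its nonactive neighbours, with `w`
      -- among them or not, are part of its type
      have hwn : w ∉ x.active := by rw [← hwx]; simp
      have hi1 : (G' i ∩ z.active).card = 1 := by simpa [ripple] using hi
      have hle1 : (G' i ∩ x.active).card ≤ 1 :=
        hi1 ▸ card_le_card (inter_subset_inter_left hle)
      rcases symbolType_eq_iff.1 (h i) with h2 | ⟨h2, -, -⟩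
      · omega
      · have := congrArg (w ∈ ·) h2
        simpa [hwn] using this
    · rfl

/-! ### The neighbourhood of one output symbol -/

/-- The neighbourhood law depends on a set only through its size. -/
lemma neighborhoodLaw_toReal {Ω : PMF ℕ} (hk : ∀ d, Ω d ≠ 0 → d ≤ k) (S : Finset (Fin k)) :
    (neighborhoodLaw Ω k S).toReal = (Ω S.card).toReal / (k.choose S.card : ℝ) := by
  have hS : S.card ≤ k := by simpa using card_le_univ S
  rw [neighborhoodLaw, PMF.bind_apply, tsum_eq_single S.card]
  · have h : (powersetCard S.card (univ : Finset (Fin k))).Nonempty := ⟨S, by simp⟩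
    rw [dif_pos h, PMF.uniformOfFinset_apply_of_mem _ (by simp)]
    simp [div_eq_mul_inv]
  · intro d hd
    by_cases h0 : Ω d = 0
    · simp [h0]
    · have h : (powersetCard d (univ : Finset (Fin k))).Nonempty := by
        simpa [powersetCard_nonempty] using hk d h0
      rw [dif_pos h, PMF.uniformOfFinset_apply_of_notMem _ (by simpa using hd.symm), mul_zero]

lemma sum_neighborhoodLaw_filter {Ω : PMF ℕ} {dmax : ℕ} (hdmax : dmax ≤ k)
    (hΩ : ∀ d, Ω d ≠ 0 → 1 ≤ d ∧ d ≤ dmax) (Q : Finset (Fin k) → Prop) [DecidablePred Q] :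
    ∑ S with Q S, (neighborhoodLaw Ω k S).toReal = ∑ d ∈ Icc 1 dmax,
      (Ω d).toReal / (k.choose d : ℝ) * (((powersetCard d univ).filter Q).card : ℝ) := by
  have hk : ∀ d, Ω d ≠ 0 → d ≤ k := fun d h => (hΩ d h).2.trans hdmax
  have h1 : ∑ S with Q S, (neighborhoodLaw Ω k S).toReal =
      ∑ S with Q S ∧ S.card ∈ Icc 1 dmax, (neighborhoodLaw Ω k S).toReal := by
    rw [← filter_filter]
    refine (sum_filter_of_ne fun S _ hne => ?_).symm
    rw [neighborhoodLaw_toReal hk] at hne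
    rw [mem_Icc]
    refine hΩ _ fun h0 => hne ?_
    simp [h0]
  rw [h1, ← sum_fiberwise_of_maps_to (g := card) (t := Icc 1 dmax)
    (fun S hS => (mem_filter.1 hS).2.2)]
  refine sum_congr rfl fun d hd => ?_
  have h2 : ((univ : Finset (Finset (Fin k))).filter fun S => Q S ∧ S.card ∈ Icc 1 dmax).filter
      (fun S => S.card = d) = (powersetCard d univ).filter Q := by
    ext S
    simp only [mem_filter, mem_univ, true_and, mem_powersetCard, subset_univ]
    constructor
    · rintro ⟨⟨h, -⟩, h'⟩; exact ⟨h', h⟩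
    · rintro ⟨h', h⟩; exact ⟨⟨h, h' ▸ hd⟩, h'⟩
  rw [h2, sum_congr rfl (g := fun _ => (Ω d).toReal / (k.choose d : ℝ)), sum_const, nsmul_eq_mul,
    mul_comm]
  intro S hS
  have : S.card = d := by simpa using (mem_filter.1 hS).1
  rw [neighborhoodLaw_toReal hk, this]

lemma card_powersetCard_filter_inter_eq {A T : Finset (Fin k)} (hT : T ⊆ A) (d : ℕ) :
    ((powersetCard d univ).filter fun S => S ∩ A = T).card =
      if T.card ≤ d then (k - A.card).choose (d - T.card) else 0 := by
  have hA : Aᶜ.card = k - A.card := by rw [card_compl, Fintype.card_fin]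
  split_ifs with h
  · rw [← hA, ← card_powersetCard]
    refine card_bij' (fun S _ => S \ A) (fun W _ => W ∪ T) ?_ ?_ ?_ ?_
    · intro S hS
      simp only [mem_filter, mem_powersetCard, subset_univ, true_and] at hS ⊢
      obtain ⟨h1, h2⟩ := hS
      refine ⟨fun a ha => by simpa using (mem_sdiff.1 ha).2, ?_⟩
      have := card_sdiff_add_card_inter S A
      rw [h2] at this
      omega
    · intro W hW
      simp only [mem_filter, mem_powersetCard, subset_univ, true_and] at hW ⊢
      have hd : Disjoint W T := by
        rw [Finset.disjoint_left]
        intro a ha ha'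
        exact mem_compl.1 (hW.1 ha) (hT ha')
      refine ⟨by rw [card_union_of_disjoint hd, hW.2]; omega, ?_⟩
      ext a
      have h1 := @hT a
      have h2 := @hW.1 a
      simp only [mem_inter, mem_union, mem_compl] at h2 ⊢
      tauto
    · intro S hS
      simp only [mem_filter] at hS
      simp only [← hS.2, sdiff_union_inter]
    · intro W hW
      simp only [mem_powersetCard] at hW
      ext a
      have h1 := @hT a
      have h2 := @hW.1 a
      simp only [mem_sdiff, mem_union, mem_compl] at h2 ⊢
      tauto
  · rw [card_eq_zero, filter_eq_empty_iff]
    intro S hS hST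
    have h1 : S.card = d := by simpa using hS
    have h2 := card_le_card (inter_subset_left (s₁ := S) (s₂ := A))
    rw [hST] at h2
    omega

/-- The probability that the active neighbours are exactly those in `T`. -/
lemma sum_neighborhoodLaw_inter_eq {Ω : PMF ℕ} {dmax : ℕ} (hdmax : dmax ≤ k)
    (hΩ : ∀ d, Ω d ≠ 0 → 1 ≤ d ∧ d ≤ dmax) {A T : Finset (Fin k)} (hT : T ⊆ A) :
    ∑ S with S ∩ A = T, (neighborhoodLaw Ω k S).toReal = ∑ d ∈ Icc 1 dmax,
      if T.card ≤ d then
        (Ω d).toReal / (k.choose d : ℝ) * ((k - A.card).choose (d - T.card) : ℝ)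
      else 0 := by
  rw [sum_neighborhoodLaw_filter hdmax hΩ]
  refine sum_congr rfl fun d _ => ?_
  rw [card_powersetCard_filter_inter_eq hT]
  split_ifs <;> simp

lemma sum_neighborhoodLaw (Ω : PMF ℕ) :
    ∑ S, (neighborhoodLaw Ω k S).toReal = 1 := by
  rw [← ENNReal.toReal_sum fun S _ => PMF.apply_ne_top _ S, ← tsum_fintype (L := .unconditional _),
    PMF.tsum_coe, ENNReal.toReal_one]

lemma sum_neighborhoodLaw_inter_card_eq_one {Ω : PMF ℕ} {dmax : ℕ} (hdmax : dmax ≤ k)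
    (hΩ : ∀ d, Ω d ≠ 0 → 1 ≤ d ∧ d ≤ dmax) (A : Finset (Fin k)) :
    ∑ S with (S ∩ A).card = 1, (neighborhoodLaw Ω k S).toReal = ∑ d ∈ Icc 1 dmax,
      (Ω d).toReal * ((A.card : ℝ) * ((k - A.card).choose (d - 1) : ℝ) / (k.choose d : ℝ)) := by
  rw [← sum_fiberwise_of_maps_to (g := fun S => S ∩ A) (t := powersetCard 1 A) (by
    intro S hS
    rw [mem_powersetCard]
    exact ⟨inter_subset_right, (mem_filter.1 hS).2⟩)]
  have h : ∀ T ∈ powersetCard 1 A,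
      ∑ S ∈ (univ.filter fun S => (S ∩ A).card = 1) with S ∩ A = T,
        (neighborhoodLaw Ω k S).toReal = ∑ d ∈ Icc 1 dmax,
          (Ω d).toReal / (k.choose d : ℝ) * ((k - A.card).choose (d - 1) : ℝ) := by
    intro T hT
    rw [mem_powersetCard] at hT
    rw [filter_filter, filter_congr (q := fun S => S ∩ A = T),
      sum_neighborhoodLaw_inter_eq hdmax hΩ hT.1, hT.2]
    · exact sum_congr rfl fun d hd => if_pos (mem_Icc.1 hd).1
    · intro S _
      exact ⟨fun h => h.2, fun h => ⟨h ▸ hT.2, h⟩⟩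
  rw [sum_congr rfl h, sum_const, card_powersetCard, Nat.choose_one_right, nsmul_eq_mul, mul_sum]
  exact sum_congr rfl fun d _ => by ring

/-- `cloudProb` is the probability of at least two active neighbours. -/
lemma sum_neighborhoodLaw_cloud {Ω : PMF ℕ} {dmax : ℕ} (hdmax : dmax ≤ k)
    (hΩ : ∀ d, Ω d ≠ 0 → 1 ≤ d ∧ d ≤ dmax) (A : Finset (Fin k)) :
    ∑ S with 2 ≤ (S ∩ A).card, (neighborhoodLaw Ω k S).toReal = cloudProb Ω k dmax A.card := by
  have h0 : ∑ S with S ∩ A = ∅, (neighborhoodLaw Ω k S).toReal = ∑ d ∈ Icc 1 dmax,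
      (Ω d).toReal * (((k - A.card).choose d : ℝ) / (k.choose d : ℝ)) := by
    rw [sum_neighborhoodLaw_inter_eq hdmax hΩ (empty_subset A)]
    refine sum_congr rfl fun d _ => ?_
    simp only [card_empty, zero_le, if_true, Nat.sub_zero]
    ring
  have h1 := sum_neighborhoodLaw_inter_card_eq_one hdmax hΩ A
  have h := sum_neighborhoodLaw (k := k) Ω
  rw [← sum_filter_add_sum_filter_not univ (fun S => 2 ≤ (S ∩ A).card),
    ← sum_filter_add_sum_filter_not (univ.filter fun S => ¬ 2 ≤ (S ∩ A).card)
      (fun S => (S ∩ A).card = 1), filter_filter, filter_filter] at h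
  have e1 : (univ.filter fun S : Finset (Fin k) => ¬ 2 ≤ (S ∩ A).card ∧ (S ∩ A).card = 1) =
      univ.filter fun S => (S ∩ A).card = 1 := filter_congr fun S _ => by omega
  have e0 : (univ.filter fun S : Finset (Fin k) => ¬ 2 ≤ (S ∩ A).card ∧ ¬ (S ∩ A).card = 1) =
      univ.filter fun S => S ∩ A = ∅ := filter_congr fun S _ => by
        rw [← card_eq_zero]; omega
  rw [e1, e0, h0, h1] at h
  rw [cloudProb]
  simp_rw [mul_add, sum_add_distrib]
  linarith

lemma card_inter_erase_eq_one_iff {A S : Finset (Fin k)} {v : Fin k} (hv : v ∈ A) :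
    2 ≤ (S ∩ A).card ∧ (S ∩ A.erase v).card = 1 ↔ v ∈ S ∧ (S ∩ A.erase v).card = 1 := by
  rw [inter_erase]
  by_cases hvS : v ∈ S
  · have : v ∈ S ∩ A := mem_inter.2 ⟨hvS, hv⟩
    rw [card_erase_of_mem this]
    simp only [hvS, true_and]
    omega
  · rw [erase_eq_of_notMem (by simp [hvS])]
    simp only [hvS, false_and, iff_false]
    omega

/-- The ratio `d (d - 1) / (k (k - 1))` converts one binomial coefficient into the other. -/
lemma inv_choose_eq {k d : ℕ} (hd : 2 ≤ d) (hdk : d ≤ k) :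
    (1 : ℝ) / (k.choose d : ℝ) =
      (d : ℝ) / k * ((d : ℝ) - 1) / ((k : ℝ) - 1) / ((k - 2).choose (d - 2) : ℝ) := by
  obtain ⟨d, rfl⟩ := Nat.exists_eq_add_of_le' hd
  obtain ⟨k, rfl⟩ := Nat.exists_eq_add_of_le' (hd.trans hdk)
  have h1 := Nat.add_one_mul_choose_eq (k + 1) (d + 1)
  have h2 := Nat.add_one_mul_choose_eq k d
  have h3 : 0 < k.choose d := Nat.choose_pos (by omega)
  have h4 : 0 < (k + 2).choose (d + 2) := Nat.choose_pos hdk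
  have h1' : ((k : ℝ) + 2) * ((k + 1).choose (d + 1) : ℝ) =
      ((k + 2).choose (d + 2) : ℝ) * ((d : ℝ) + 2) := by
    have := congrArg (Nat.cast (R := ℝ)) h1
    push_cast at this
    rw [← sub_eq_zero] at this ⊢
    rw [← this]
    ring
  have h2' : ((k : ℝ) + 1) * (k.choose d : ℝ) =
      ((k + 1).choose (d + 1) : ℝ) * ((d : ℝ) + 1) := by exact_mod_cast h2
  have h3' : (k.choose d : ℝ) ≠ 0 := by positivity
  have h4' : ((k + 2).choose (d + 2) : ℝ) ≠ 0 := by positivity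
  have e1 : (k : ℝ) + 2 - 1 = k + 1 := by ring
  have e2 : (d : ℝ) + 2 - 1 = d + 1 := by ring
  simp only [Nat.add_sub_cancel]
  push_cast
  rw [e1, e2]
  have p1 : (k : ℝ) + 1 ≠ 0 := by positivity
  have p2 : (k : ℝ) + 2 ≠ 0 := by positivity
  field_simp
  linear_combination ((k : ℝ) + 2) * h2' + ((d : ℝ) + 1) * h1'

/-- `cloudToRippleProb` is the probability of exactly two active neighbours, one of which is `v`. -/
lemma sum_neighborhoodLaw_leave {Ω : PMF ℕ} {dmax : ℕ} (hdmax : dmax ≤ k)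
    (hΩ : ∀ d, Ω d ≠ 0 → 1 ≤ d ∧ d ≤ dmax) {A : Finset (Fin k)} {v : Fin k} (hv : v ∈ A) :
    ∑ S with 2 ≤ (S ∩ A).card ∧ (S ∩ A.erase v).card = 1, (neighborhoodLaw Ω k S).toReal =
      cloudToRippleProb Ω k dmax A.card := by
  simp_rw [card_inter_erase_eq_one_iff hv]
  rw [← sum_fiberwise_of_maps_to (g := fun S => S ∩ A) (t := (A.erase v).image fun w => {v, w})]
  · rw [sum_image]
    · have h : ∀ w ∈ A.erase v,
          ∑ S ∈ (univ.filter fun S => v ∈ S ∧ (S ∩ A.erase v).card = 1) with S ∩ A = {v, w},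
            (neighborhoodLaw Ω k S).toReal = ∑ d ∈ Icc 1 dmax, if 2 ≤ d then
              (Ω d).toReal / (k.choose d : ℝ) * ((k - A.card).choose (d - 2) : ℝ) else 0 := by
        intro w hw
        rw [mem_erase] at hw
        have hc : ({v, w} : Finset (Fin k)).card = 2 := card_pair hw.1.symm
        have hs : ({v, w} : Finset (Fin k)) ⊆ A := by
          intro a; simp only [mem_insert, mem_singleton]; rintro (rfl | rfl)
          exacts [hv, hw.2]
        rw [filter_filter, filter_congr (q := fun S => S ∩ A = {v, w}),
          sum_neighborhoodLaw_inter_eq hdmax hΩ hs, hc]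
        intro S _
        refine ⟨fun h => h.2, fun h => ⟨⟨?_, ?_⟩, h⟩⟩
        · have : v ∈ S ∩ A := by rw [h]; simp
          exact (mem_inter.1 this).1
        · rw [inter_erase, h, card_erase_of_mem (by simp), hc]
      rw [sum_congr rfl h, sum_const, card_erase_of_mem hv, nsmul_eq_mul, ← sum_filter, mul_sum,
        cloudToRippleProb, Nat.cast_sub (card_pos.2 ⟨v, hv⟩), Nat.cast_one]
      have hI : (Icc 1 dmax).filter (fun d => 2 ≤ d) = Icc 2 dmax := by
        ext d; simp only [mem_filter, mem_Icc]; omega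
      rw [hI]
      refine sum_congr rfl fun d hd => ?_
      rw [mem_Icc] at hd
      rw [div_eq_mul_one_div ((Ω d).toReal), inv_choose_eq hd.1 (hd.2.trans hdmax)]
      ring
    · intro w hw w' hw' h
      simp only [coe_erase, Set.mem_sdiff, mem_coe, Set.mem_singleton_iff] at hw hw'
      have : w ∈ ({v, w'} : Finset (Fin k)) := by
        rw [← show ({v, w} : Finset (Fin k)) = {v, w'} from h]; simp
      simp only [mem_insert, mem_singleton] at this
      tauto
  · intro S hS
    simp only [mem_filter, mem_univ, true_and] at hS
    obtain ⟨w, hw⟩ := card_eq_one.1 hS.2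
    have hwA : w ∈ S ∩ A.erase v := by rw [hw]; simp
    refine mem_image.2 ⟨w, (mem_inter.1 hwA).2, ?_⟩
    rw [← hw, inter_erase, insert_erase (mem_inter.2 ⟨hS.1, hv⟩)]

/-- Multiplied by the cloud probability, `leaveProb` gives back its numerator, also when the cloud
is almost surely empty. -/
lemma leaveProb_mul_cloudProb {Ω : PMF ℕ} {dmax : ℕ} (hdmax : dmax ≤ k)
    (hΩ : ∀ d, Ω d ≠ 0 → 1 ≤ d ∧ d ≤ dmax) {A : Finset (Fin k)} {v : Fin k} (hv : v ∈ A) :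
    leaveProb Ω k dmax A.card * cloudProb Ω k dmax A.card =
      cloudToRippleProb Ω k dmax A.card := by
  by_cases h : cloudProb Ω k dmax A.card = 0
  · have h1 := sum_neighborhoodLaw_cloud hdmax hΩ A
    have h2 := sum_neighborhoodLaw_leave hdmax hΩ hv
    have h3 : ∑ S with 2 ≤ (S ∩ A).card ∧ (S ∩ A.erase v).card = 1,
        (neighborhoodLaw Ω k S).toReal ≤
          ∑ S with 2 ≤ (S ∩ A).card, (neighborhoodLaw Ω k S).toReal :=
      sum_le_sum_of_subset_of_nonneg (monotone_filter_right _ fun S _ hS => hS.1)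
        fun _ _ _ => ENNReal.toReal_nonneg
    have h4 : 0 ≤ ∑ S with 2 ≤ (S ∩ A).card ∧ (S ∩ A.erase v).card = 1,
        (neighborhoodLaw Ω k S).toReal := sum_nonneg fun _ _ => ENNReal.toReal_nonneg
    rw [h, mul_zero]
    linarith
  · rw [leaveProb, div_mul_cancel₀ _ h]

/-! ### Averages over the sets of a given type -/

lemma sum_mul_ite_iff {α : Type*} (s : Finset α) (w : α → ℝ) (Q : α → Prop) [DecidablePred Q]
    (b : Prop) [Decidable b] {c : ℝ}
    (h : ∑ a ∈ s, w a * (if Q a then 1 else 0) = c * ∑ a ∈ s, w a) :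
    ∑ a ∈ s, w a * (if (Q a ↔ b) then 1 else 0) = (if b then c else 1 - c) * ∑ a ∈ s, w a := by
  by_cases hb : b
  · simpa [hb] using h
  · have h1 : ∀ a, w a * (if (Q a ↔ b) then (1 : ℝ) else 0) =
        w a - w a * (if Q a then 1 else 0) := by
      intro a
      by_cases hQ : Q a <;> simp [hQ, hb]
    rw [sum_congr rfl fun a _ => h1 a, sum_sub_distrib, h, if_neg hb]
    ring

/-- Among the sets of cloud type, the removal of `v` leaves a single active neighbour with the
conditional probability `leaveProb`. -/
lemma sum_symbolType_cloud {Ω : PMF ℕ} {dmax : ℕ} (hdmax : dmax ≤ k)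
    (hΩ : ∀ d, Ω d ≠ 0 → 1 ≤ d ∧ d ≤ dmax) {A S₀ : Finset (Fin k)} {v : Fin k} (hv : v ∈ A)
    (hS₀ : 2 ≤ (S₀ ∩ A).card) :
    ∑ S with symbolType A S = symbolType A S₀,
        (neighborhoodLaw Ω k S).toReal * (if (S ∩ A.erase v).card = 1 then 1 else 0) =
      leaveProb Ω k dmax A.card *
        ∑ S with symbolType A S = symbolType A S₀, (neighborhoodLaw Ω k S).toReal := by
  have h : (univ.filter fun S => symbolType A S = symbolType A S₀) =
      univ.filter fun S => 2 ≤ (S ∩ A).card := by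
    refine filter_congr fun S _ => ?_
    rw [symbolType_eq_iff]
    omega
  rw [h, sum_neighborhoodLaw_cloud hdmax hΩ, leaveProb_mul_cloudProb hdmax hΩ hv,
    ← sum_neighborhoodLaw_leave hdmax hΩ hv, ← filter_filter,
    sum_filter (p := fun S : Finset (Fin k) => (S ∩ A.erase v).card = 1)]
  simp

/-- Among the sets of a given ripple type, the active neighbour is uniform. -/
lemma sum_symbolType_ripple {Ω : PMF ℕ} (hk : ∀ d, Ω d ≠ 0 → d ≤ k)
    {A S₀ : Finset (Fin k)} {v : Fin k} (hv : v ∈ A) (hS₀ : (S₀ ∩ A).card = 1) :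
    ∑ S with symbolType A S = symbolType A S₀,
        (neighborhoodLaw Ω k S).toReal * (if v ∈ S then 1 else 0) =
      1 / (A.card : ℝ) *
        ∑ S with symbolType A S = symbolType A S₀, (neighborhoodLaw Ω k S).toReal := by
  have hnot : ∀ a ∈ A, a ∉ S₀ \ A := fun a ha h => (mem_sdiff.1 h).2 ha
  have hfib : (univ.filter fun S => symbolType A S = symbolType A S₀) =
      A.image fun a => insert a (S₀ \ A) := by
    ext S
    simp only [mem_filter, mem_univ, true_and, mem_image]
    rw [symbolType_eq_iff]
    constructor
    · rintro (h | ⟨h1, h2, h3⟩)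
      · omega
      · rw [hS₀] at h2
        obtain ⟨a, ha⟩ := card_eq_one.1 h2
        have haA : a ∈ S ∩ A := by rw [ha]; simp
        refine ⟨a, (mem_inter.1 haA).2, ?_⟩
        rw [← h1, insert_eq, ← ha, union_comm, sdiff_union_inter]
    · rintro ⟨a, ha, rfl⟩
      have hi : insert a (S₀ \ A) ∩ A = {a} := by
        ext b
        simp only [mem_inter, mem_insert, mem_sdiff, mem_singleton]
        constructor
        · rintro ⟨h | h, h'⟩
          · exact h
          · exact absurd h' h.2
        · rintro rfl
          exact ⟨Or.inl rfl, ha⟩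
      right
      rw [hi, hS₀, card_singleton]
      refine ⟨?_, rfl, le_rfl⟩
      ext b
      simp only [mem_sdiff, mem_insert]
      constructor
      · rintro ⟨h | h, h'⟩
        · exact absurd (h ▸ ha) h'
        · exact h
      · exact fun h => ⟨Or.inr h, h.2⟩
  have hinj : Set.InjOn (fun a => insert a (S₀ \ A)) (A : Set (Fin k)) := by
    intro a ha b hb h
    have : a ∈ insert b (S₀ \ A) := by
      rw [← show insert a (S₀ \ A) = insert b (S₀ \ A) from h]; exact mem_insert_self _ _
    rcases mem_insert.1 this with h | h
    · exact h
    · exact absurd h (hnot a ha)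
  rw [hfib, sum_image hinj, sum_image hinj]
  have hw : ∀ a ∈ A, (neighborhoodLaw Ω k (insert a (S₀ \ A))).toReal =
      (neighborhoodLaw Ω k (insert v (S₀ \ A))).toReal := by
    intro a ha
    rw [neighborhoodLaw_toReal hk, neighborhoodLaw_toReal hk, card_insert_of_notMem (hnot a ha),
      card_insert_of_notMem (hnot v hv)]
  have hA : (A.card : ℝ) ≠ 0 := by
    have := card_pos.2 ⟨v, hv⟩
    positivity
  rw [sum_congr rfl hw, sum_const, nsmul_eq_mul, sum_eq_single_of_mem v hv]
  · simp only [mem_insert_self, if_true]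
    field_simp
  · intro a ha hne
    have : v ∉ insert a (S₀ \ A) := by
      simp only [mem_insert, not_or]
      exact ⟨hne.symm, hnot v hv⟩
    simp [this]

/-! ### Resampling independent coordinates -/

/-- Let `H` depend on independent coordinates only through their types. If, within every type that
matters for `H`, the factor `φ i` averages to `c i`, then `∏ i, φ i` may be replaced by
`∏ i, c i`. -/
lemma sum_prod_mul_prod_of_fiber {ι α T : Type*} [Fintype ι] [DecidableEq ι] [Fintype α]
    [DecidableEq T] (w : α → ℝ) (φ : ι → α → ℝ) (c : ι → ℝ) (τ : α → T) (H : (ι → α) → ℝ)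
    (hH : ∀ g g', (∀ i, τ (g i) = τ (g' i)) → H g = H g')
    (hc : ∀ g, H g ≠ 0 → ∀ i, ∑ a with τ a = τ (g i), w a * φ i a =
      c i * ∑ a with τ a = τ (g i), w a) :
    ∑ g : ι → α, (∏ i, w (g i)) * (H g * ∏ i, φ i (g i)) =
      (∏ i, c i) * ∑ g : ι → α, (∏ i, w (g i)) * H g := by
  classical
  have hmaps : ∀ g ∈ (univ : Finset (ι → α)), (fun i => τ (g i)) ∈
      (univ : Finset (ι → α)).image fun g i => τ (g i) :=
    fun g _ => mem_image_of_mem (fun (g : ι → α) i => τ (g i)) (mem_univ g)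
  rw [← sum_fiberwise_of_maps_to hmaps, ← sum_fiberwise_of_maps_to hmaps, mul_sum]
  refine sum_congr rfl fun t ht => ?_
  obtain ⟨g₀, -, rfl⟩ := mem_image.1 ht
  have hfib : (univ.filter fun g : ι → α => (fun i => τ (g i)) = fun i => τ (g₀ i)) =
      Fintype.piFinset fun i => univ.filter fun a => τ a = τ (g₀ i) := by
    ext g
    simp [Fintype.mem_piFinset, funext_iff]
  have hHc : ∀ g ∈ Fintype.piFinset fun i => univ.filter fun a => τ a = τ (g₀ i),
      H g = H g₀ := by
    intro g hg
    refine hH g g₀ fun i => ?_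
    simpa using Fintype.mem_piFinset.1 hg i
  rw [hfib, sum_congr rfl (g := fun g => H g₀ * ∏ i, (w (g i) * φ i (g i))),
    sum_congr (s₁ := Fintype.piFinset _) rfl
      (f := fun g => (∏ i, w (g i)) * H g) (g := fun g => H g₀ * ∏ i, w (g i)),
    ← mul_sum, ← mul_sum, ← prod_univ_sum _ (fun _ a => w a),
    ← prod_univ_sum _ (fun i a => w a * φ i a)]
  · by_cases h0 : H g₀ = 0
    · simp [h0]
    · rw [prod_congr rfl fun i _ => hc g₀ h0 i, prod_mul_distrib]
      ring
  · intro g hg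
    rw [hHc g hg, mul_comm]
  · intro g hg
    rw [hHc g hg, prod_mul_distrib]
    ring

/-! ### Symbols leaving the cloud and the ripple -/

/-- The cloud symbols that keep a single active neighbour once `v` is removed. -/
def leaveCloud (G : Fin m → Finset (Fin k)) (A : Finset (Fin k)) (v : Fin k) : Finset (Fin m) :=
  (cloud G A).filter fun i => (G i ∩ A.erase v).card = 1

/-- The ripple symbols whose active neighbour is `v`. -/
def leaveRipple (G : Fin m → Finset (Fin k)) (A : Finset (Fin k)) (v : Fin k) : Finset (Fin m) :=
  (ripple G A).filter fun i => v ∈ G i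

lemma card_inter_erase {A S : Finset (Fin k)} {v : Fin k} (hv : v ∈ A) :
    (S ∩ A.erase v).card + (if v ∈ S then 1 else 0) = (S ∩ A).card := by
  rw [inter_erase]
  split_ifs with h
  · exact card_erase_add_one (mem_inter.2 ⟨h, hv⟩)
  · rw [erase_eq_of_notMem (by simp [h]), add_zero]

lemma cloud_erase (G : Fin m → Finset (Fin k)) {A : Finset (Fin k)} {v : Fin k} (hv : v ∈ A) :
    cloud G (A.erase v) = cloud G A \ leaveCloud G A v := by
  ext i
  have := card_inter_erase (S := G i) hv
  simp only [cloud, leaveCloud, mem_sdiff, mem_filter, mem_univ, true_and]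
  split_ifs at this <;> omega

lemma ripple_erase (G : Fin m → Finset (Fin k)) {A : Finset (Fin k)} {v : Fin k} (hv : v ∈ A) :
    ripple G (A.erase v) = (ripple G A \ leaveRipple G A v) ∪ leaveCloud G A v := by
  ext i
  have := card_inter_erase (S := G i) hv
  simp only [ripple, cloud, leaveCloud, leaveRipple, mem_sdiff, mem_filter, mem_univ, true_and,
    mem_union]
  by_cases h : v ∈ G i <;> simp only [h, if_true, if_false] at this <;> 
    simp only [h, and_true, and_false, not_false_eq_true] <;> omega

/-- The probability that exactly the symbols in `B`, out of the set `C`, succeed in independent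
trials with success probability `p`. -/
noncomputable def subsetWeight (p : ℝ) (C B : Finset (Fin m)) : ℝ :=
  p ^ B.card * (1 - p) ^ (C \ B).card

lemma prod_ite_eq_subsetWeight (p : ℝ) {C B : Finset (Fin m)} (hB : B ⊆ C) :
    ∏ i, (if i ∈ C then (if i ∈ B then p else 1 - p) else 1) = subsetWeight p C B := by
  rw [prod_ite_mem, univ_inter, prod_ite, prod_const, prod_const, filter_mem_eq_inter,
    inter_eq_right.2 hB, subsetWeight, ← sdiff_eq_filter]

lemma prod_ite_iff_eq {C B E : Finset (Fin m)} (hB : B ⊆ C) (hE : E ⊆ C) (Q : Fin m → Prop)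
    [DecidablePred Q] (hQ : ∀ i ∈ C, Q i ↔ i ∈ E) :
    ∏ i, (if i ∈ C then (if (Q i ↔ i ∈ B) then (1 : ℝ) else 0) else 1) =
      if E = B then 1 else 0 := by
  split_ifs with h
  · subst h
    refine prod_eq_one fun i _ => ?_
    split_ifs with h1 h2
    · rfl
    · exact absurd (hQ i h1) h2
    · rfl
  · have : ∃ i ∈ C, ¬ (i ∈ E ↔ i ∈ B) := by
      by_contra hc
      push Not at hc
      refine h ?_
      ext i
      by_cases hi : i ∈ C
      · exact hc i hi
      · exact ⟨fun h => absurd (hE h) hi, fun h => absurd (hB h) hi⟩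
    obtain ⟨i, hi, hne⟩ := this
    refine prod_eq_zero (mem_univ i) ?_
    rw [if_pos hi, if_neg (by rwa [hQ i hi])]

lemma graphLaw_toReal (Ω : PMF ℕ) (G : Fin m → Finset (Fin k)) :
    (graphLaw Ω k m G).toReal = ∏ i, (neighborhoodLaw Ω k (G i)).toReal := by
  rw [graphLaw, iidLaw, PMF.ofFintype_apply, ENNReal.toReal_prod]

/-- Conditionally on the marks, the cloud `C` and the ripple `R`, and for each active `v`, the cloud
symbols that would fall into the ripple on removal of `v` and the ripple symbols attached to `v`
are chosen by independent trials. -/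
lemma sum_graphLaw_leave {Ω : PMF ℕ} {dmax : ℕ} (hdmax : dmax ≤ k)
    (hΩ : ∀ d, Ω d ≠ 0 → 1 ≤ d ∧ d ≤ dmax) {t : ℕ} (ht : t ≤ k) (x : Marks k) {v : Fin k}
    (hv : v ∈ x.active) {C R B D : Finset (Fin m)} (hB : B ⊆ C) (hD : D ⊆ R) :
    ∑ G with cloud G x.active = C ∧ ripple G x.active = R,
      (graphLaw Ω k m G).toReal * ((chain G t x).toReal *
        if leaveCloud G x.active v = B ∧ leaveRipple G x.active v = D then 1 else 0) =
      subsetWeight (leaveProb Ω k dmax x.active.card) C B *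
          subsetWeight (1 / (x.active.card : ℝ)) R D *
        ∑ G with cloud G x.active = C ∧ ripple G x.active = R,
          (graphLaw Ω k m G).toReal * (chain G t x).toReal := by
  have hk : ∀ d, Ω d ≠ 0 → d ≤ k := fun d h => (hΩ d h).2.trans hdmax
  set A := x.active with hA
  set p := leaveProb Ω k dmax A.card
  let H : (Fin m → Finset (Fin k)) → ℝ := fun G =>
    if cloud G A = C ∧ ripple G A = R then (chain G t x).toReal else 0
  have key := sum_prod_mul_prod_of_fiber (ι := Fin m)
    (fun S : Finset (Fin k) => (neighborhoodLaw Ω k S).toReal)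
    (fun i S => (if i ∈ C then (if ((S ∩ A.erase v).card = 1 ↔ i ∈ B) then 1 else 0) else 1) *
      (if i ∈ R then (if (v ∈ S ↔ i ∈ D) then 1 else 0) else 1))
    (fun i => (if i ∈ C then (if i ∈ B then p else 1 - p) else 1) *
      (if i ∈ R then (if i ∈ D then 1 / (A.card : ℝ) else 1 - 1 / (A.card : ℝ)) else 1))
    (symbolType A) H ?_ ?_
  · rw [prod_mul_distrib, prod_ite_eq_subsetWeight p hB, prod_ite_eq_subsetWeight _ hD] at key
    rw [sum_filter, sum_filter]
    refine (sum_congr rfl fun G _ => ?_).trans (key.trans (congrArg _ (sum_congr rfl fun G _ => ?_)))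
    · rw [graphLaw_toReal, prod_mul_distrib]
      by_cases hG : cloud G A = C ∧ ripple G A = R
      · simp only [H, if_pos hG]
        rw [prod_ite_iff_eq (E := leaveCloud G A v) hB (hG.1 ▸ filter_subset _ _),
          prod_ite_iff_eq (E := leaveRipple G A v) hD (hG.2 ▸ filter_subset _ _)]
        · congr 2
          rw [ite_and]
          split_ifs <;> simp
        · intro i hi; simp [leaveRipple, hG.2, hi]
        · intro i hi; simp [leaveCloud, hG.1, hi]
      · simp only [H, if_neg hG, zero_mul, mul_zero]
    · rw [graphLaw_toReal]
      simp only [H, mul_ite, mul_zero]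
  · intro G G' h
    simp only [H, cloud_eq_of_symbolType h, ripple_eq_of_symbolType h,
      chain_eq_of_symbolType G G' ht x h]
  · intro G hG i
    have hCR : cloud G A = C ∧ ripple G A = R := by
      by_contra hc
      exact hG (if_neg hc)
    obtain ⟨rfl, rfl⟩ := hCR
    by_cases hiC : i ∈ cloud G A
    · have hiR := disjoint_left.1 (disjoint_cloud_ripple G A) hiC
      simp only [hiC, hiR, if_true, if_false, mul_one]
      refine sum_mul_ite_iff _ _ _ _ (sum_symbolType_cloud hdmax hΩ hv ?_)
      simpa [cloud] using hiC
    · by_cases hiR : i ∈ ripple G A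
      · simp only [hiC, hiR, if_true, if_false, one_mul]
        refine sum_mul_ite_iff _ _ _ _ (sum_symbolType_ripple hk hv ?_)
        simpa [ripple] using hiR
      · simp only [hiC, hiR, if_false, mul_one, one_mul]

/-! ### The transition kernel on clouds and ripples -/

/-- The expectation of `F` (of cloud, ripple and number of inactivations) after one step from cloud
`C`, ripple `R` and `n` inactivations: the set `B` moves from the cloud to the ripple and the set
`D` leaves the ripple. The factor `D.card / R.card` is the chance that the selected ripple symbol
is in `D`, and `u` counts the possible common neighbours of `D`. -/
noncomputable def kernelExpect (p : ℝ) (u : ℕ) (C R : Finset (Fin m)) (n : ℕ)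
    (F : Finset (Fin m) → Finset (Fin m) → ℕ → ℝ) : ℝ :=
  if R.Nonempty then
    ∑ B ∈ C.powerset, ∑ D ∈ R.powerset, subsetWeight p C B *
      ((D.card : ℝ) / R.card * u * subsetWeight (1 / (u : ℝ)) R D) * F (C \ B) ((R \ D) ∪ B) n
  else ∑ B ∈ C.powerset, subsetWeight p C B * F (C \ B) B (n + 1)

lemma eq_sum_powerset_ite {C R E E' : Finset (Fin m)} (hE : E ⊆ C) (hE' : E' ⊆ R)
    (f : Finset (Fin m) → Finset (Fin m) → ℝ) :
    f E E' = ∑ B ∈ C.powerset, ∑ D ∈ R.powerset, (if E = B ∧ E' = D then 1 else 0) * f B D := by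
  rw [sum_eq_single_of_mem E (mem_powerset.2 hE), sum_eq_single_of_mem E' (mem_powerset.2 hE')]
  · simp
  · intro D _ h
    simp [h.symm]
  · intro B _ h
    simp [h.symm]

lemma sum_graphLaw_step {Ω : PMF ℕ} {dmax : ℕ} (hdmax : dmax ≤ k)
    (hΩ : ∀ d, Ω d ≠ 0 → 1 ≤ d ∧ d ≤ dmax) {t : ℕ} (ht : t ≤ k) (x : Marks k)
    (hx : x.active.Nonempty) (hdisj : Disjoint x.active x.inactive) (C R : Finset (Fin m))
    (F : Finset (Fin m) → Finset (Fin m) → ℕ → ℝ) :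
    ∑ G with cloud G x.active = C ∧ ripple G x.active = R,
      (graphLaw Ω k m G).toReal * ((chain G t x).toReal *
        expect (step G x) fun y => F (cloud G y.active) (ripple G y.active) y.inactive.card) =
      kernelExpect (leaveProb Ω k dmax x.active.card) x.active.card C R x.inactive.card F *
        ∑ G with cloud G x.active = C ∧ ripple G x.active = R,
          (graphLaw Ω k m G).toReal * (chain G t x).toReal := by
  have hu : (x.active.card : ℝ) ≠ 0 := by
    have := card_pos.2 hx
    positivity
  -- `g B D` stands for the chance that `v` is removed times the value of `F` afterwards, when `B`
  -- and `D` are the sets of symbols that `v` makes leave the cloud and the ripple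
  have main : ∀ g : Finset (Fin m) → Finset (Fin m) → ℝ,
      (∀ G, cloud G x.active = C → ripple G x.active = R →
        (expect (step G x) fun y => F (cloud G y.active) (ripple G y.active) y.inactive.card) =
          ∑ v ∈ x.active, g (leaveCloud G x.active v) (leaveRipple G x.active v)) →
      ∑ G with cloud G x.active = C ∧ ripple G x.active = R,
        (graphLaw Ω k m G).toReal * ((chain G t x).toReal *
          expect (step G x) fun y => F (cloud G y.active) (ripple G y.active) y.inactive.card) =
      (∑ B ∈ C.powerset, ∑ D ∈ R.powerset, x.active.card *
        (subsetWeight (leaveProb Ω k dmax x.active.card) C B *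
          subsetWeight (1 / (x.active.card : ℝ)) R D) * g B D) *
        ∑ G with cloud G x.active = C ∧ ripple G x.active = R,
          (graphLaw Ω k m G).toReal * (chain G t x).toReal := by
    intro g hg
    have h1 : ∀ G ∈ univ.filter fun G => cloud G x.active = C ∧ ripple G x.active = R,
        (graphLaw Ω k m G).toReal * ((chain G t x).toReal *
          expect (step G x) fun y => F (cloud G y.active) (ripple G y.active) y.inactive.card) =
        ∑ v ∈ x.active, ∑ B ∈ C.powerset, ∑ D ∈ R.powerset, g B D *
          ((graphLaw Ω k m G).toReal * ((chain G t x).toReal *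
            if leaveCloud G x.active v = B ∧ leaveRipple G x.active v = D then 1 else 0)) := by
      intro G hG
      obtain ⟨hC, hR⟩ := (mem_filter.1 hG).2
      rw [hg G hC hR, mul_sum, mul_sum]
      refine sum_congr rfl fun v _ => ?_
      rw [eq_sum_powerset_ite (C := C) (R := R) (hC ▸ filter_subset _ _) (hR ▸ filter_subset _ _) g,
        mul_sum, mul_sum]
      refine sum_congr rfl fun B _ => ?_
      rw [mul_sum, mul_sum]
      exact sum_congr rfl fun D _ => by ring
    rw [sum_congr rfl h1, sum_comm]
    have h2 : ∀ v ∈ x.active, ∑ G with cloud G x.active = C ∧ ripple G x.active = R,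
        ∑ B ∈ C.powerset, ∑ D ∈ R.powerset, g B D *
          ((graphLaw Ω k m G).toReal * ((chain G t x).toReal *
            if leaveCloud G x.active v = B ∧ leaveRipple G x.active v = D then 1 else 0)) =
        ∑ B ∈ C.powerset, ∑ D ∈ R.powerset, g B D *
          (subsetWeight (leaveProb Ω k dmax x.active.card) C B *
            subsetWeight (1 / (x.active.card : ℝ)) R D *
          ∑ G with cloud G x.active = C ∧ ripple G x.active = R,
            (graphLaw Ω k m G).toReal * (chain G t x).toReal) := by
      intro v hv
      rw [sum_comm]
      refine sum_congr rfl fun B hB => ?_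
      rw [sum_comm]
      refine sum_congr rfl fun D hD => ?_
      rw [← mul_sum, sum_graphLaw_leave hdmax hΩ ht x hv (mem_powerset.1 hB) (mem_powerset.1 hD)]
    rw [sum_congr rfl h2, sum_const, nsmul_eq_mul, mul_sum, sum_mul]
    refine sum_congr rfl fun B _ => ?_
    rw [mul_sum, sum_mul]
    exact sum_congr rfl fun D _ => by ring
  unfold kernelExpect
  split_ifs with hR
  · rw [main fun B D => (D.card : ℝ) / R.card * F (C \ B) ((R \ D) ∪ B) x.inactive.card]
    · congr 1
      exact sum_congr rfl fun B _ => sum_congr rfl fun D _ => by ring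
    · rintro G rfl rfl
      rw [expect_step G x hx, if_pos hR]
      refine sum_congr rfl fun v hv => ?_
      rw [cloud_erase G hv, ripple_erase G hv]
      rfl
  · rw [main fun B D => 1 / (x.active.card : ℝ) * F (C \ B) B (x.inactive.card + 1)]
    · rw [not_nonempty_iff_eq_empty] at hR
      subst hR
      congr 1
      refine sum_congr rfl fun B _ => ?_
      rw [powerset_empty, sum_singleton]
      simp only [subsetWeight, card_empty, sdiff_empty, pow_zero]
      field_simp
    · rintro G rfl rfl
      rw [expect_step G x hx, if_neg hR]
      refine sum_congr rfl fun v hv => ?_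
      rw [cloud_erase G hv, ripple_erase G hv, card_insert_of_notMem (disjoint_left.1 hdisj hv),
        not_nonempty_iff_eq_empty.1 hR, empty_sdiff, empty_union]

/-- If the kernel gives `F` the same probability `c` from all clouds and ripples satisfying `Q`, then
`c` is the conditional probability of `F` at stage `u - 1` given `Q` at stage `u`. -/
lemma Pr_real_and_eq_mul {Ω : PMF ℕ} {dmax : ℕ} (hdmax : dmax ≤ k)
    (hΩ : ∀ d, Ω d ≠ 0 → 1 ≤ d ∧ d ≤ dmax) {u : ℕ} (hu : 1 ≤ u) (huk : u ≤ k)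
    (Q F : Finset (Fin m) → Finset (Fin m) → ℕ → Prop)
    [∀ C R n, Decidable (Q C R n)] [∀ C R n, Decidable (F C R n)] (c : ℝ)
    (h : ∀ C R n, Disjoint C R → Q C R n →
      kernelExpect (leaveProb Ω k dmax u) u C R n (fun C R n => if F C R n then 1 else 0) = c) :
    (Pr Ω k m).real {ω | Q (cloudAt u ω) (rippleAt u ω) (ω.marks u).inactive.card ∧
        F (cloudAt (u - 1) ω) (rippleAt (u - 1) ω) (ω.marks (u - 1)).inactive.card} =
      c * (Pr Ω k m).real {ω | Q (cloudAt u ω) (rippleAt u ω) (ω.marks u).inactive.card} := by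
  have e1 := Pr_real_eq_expect (m := m) Ω hu huk (fun G x y =>
    Q (cloud G x.active) (ripple G x.active) x.inactive.card ∧
      F (cloud G y.active) (ripple G y.active) y.inactive.card)
  have e2 := Pr_real_eq_expect (m := m) Ω hu huk (fun G x _ =>
    Q (cloud G x.active) (ripple G x.active) x.inactive.card)
  refine e1.trans (Eq.trans ?_ (congrArg (c * ·) e2).symm)
  have eg : ∀ f, expect (graphLaw Ω k m) f = ∑ G, (graphLaw Ω k m G).toReal * f G := fun _ => rfl
  have ec : ∀ (G : Fin m → Finset (Fin k)) f,
      expect (chain G (k - u)) f = ∑ x, (chain G (k - u) x).toReal * f x := fun _ _ => rfl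
  simp only [eg, ec, mul_sum]
  rw [sum_comm, sum_comm (s := univ (α := Fin m → Finset (Fin k)))]
  refine sum_congr rfl fun x _ => ?_
  by_cases hx : x.active.card = u ∧ Disjoint x.active x.inactive
  swap
  · have h0 : ∀ G : Fin m → Finset (Fin k), chain G (k - u) x = 0 := by
      intro G
      by_contra hc
      have := card_active_of_chain_ne_zero G (by omega) x hc
      exact hx ⟨by omega, this.2⟩
    simp [h0]
  obtain ⟨hxu, hdisj⟩ := hx
  have hne : x.active.Nonempty := by rw [← card_pos]; omega
  rw [← sum_fiberwise univ
      (fun G : Fin m → Finset (Fin k) => (cloud G x.active, ripple G x.active)),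
    ← sum_fiberwise univ
      (fun G : Fin m → Finset (Fin k) => (cloud G x.active, ripple G x.active))]
  refine sum_congr rfl fun CR _ => ?_
  obtain ⟨C, R⟩ := CR
  simp only [Prod.mk.injEq]
  by_cases hCR : Disjoint C R
  swap
  · rw [filter_false_of_mem, sum_empty, sum_empty]
    rintro G - ⟨rfl, rfl⟩
    exact hCR (disjoint_cloud_ripple G _)
  by_cases hQ : Q C R x.inactive.card
  · have hs := sum_graphLaw_step hdmax hΩ (t := k - u) (by omega) x hne hdisj C R
      (fun C R n => if F C R n then 1 else 0)
    rw [hxu, h C R _ hCR hQ, mul_sum] at hs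
    refine Eq.trans (sum_congr rfl fun G hG => ?_) (hs.trans (sum_congr rfl fun G hG => ?_))
    · obtain ⟨hC, hR⟩ := (mem_filter.1 hG).2
      simp only [hC, hR, hQ, true_and]
    · obtain ⟨hC, hR⟩ := (mem_filter.1 hG).2
      simp only [hC, hR, hQ, if_true, expect_const, mul_one]
  · refine sum_congr rfl fun G hG => ?_
    obtain ⟨hC, hR⟩ := (mem_filter.1 hG).2
    simp [hC, hR, hQ, expect]

/-! ### Summing the kernel over sets of given sizes -/

lemma sum_powerset_subsetWeight (p : ℝ) (C : Finset (Fin m)) (f : ℕ → ℝ) :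
    ∑ B ∈ C.powerset, subsetWeight p C B * f B.card =
      ∑ b ∈ range (C.card + 1), (C.card.choose b : ℝ) * p ^ b * (1 - p) ^ (C.card - b) * f b := by
  have h := sum_powerset_apply_card (x := C) fun b => p ^ b * (1 - p) ^ (C.card - b) * f b
  refine Eq.trans (sum_congr rfl fun B hB => ?_) (h.trans (sum_congr rfl fun b _ => ?_))
  · rw [subsetWeight, card_sdiff_of_subset (mem_powerset.1 hB)]
  · rw [nsmul_eq_mul]
    ring

/-- Weighting `D` by its share of the ripple accounts for the selected symbol: it is one of the
`D.card` symbols that leave, and the other ripple symbols follow it independently. -/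
lemma sum_powerset_ripple {u : ℕ} (hu : 1 ≤ u) {R : Finset (Fin m)} (hR : R.Nonempty)
    (f : ℕ → ℝ) :
    ∑ D ∈ R.powerset, ((D.card : ℝ) / R.card * u * subsetWeight (1 / (u : ℝ)) R D) * f D.card =
      ∑ a ∈ Icc 1 R.card, ((R.card - 1).choose (a - 1) : ℝ) * (1 / (u : ℝ)) ^ (a - 1) *
        (1 - 1 / (u : ℝ)) ^ (R.card - a) * f a := by
  have hu0 : (u : ℝ) ≠ 0 := by positivity
  have hr : 0 < R.card := card_pos.2 hR
  have hr0 : (R.card : ℝ) ≠ 0 := by positivity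
  have h1 := sum_powerset_subsetWeight (1 / (u : ℝ)) R fun a => (a : ℝ) / R.card * u * f a
  rw [sum_congr rfl (g := fun D => subsetWeight (1 / (u : ℝ)) R D *
    ((D.card : ℝ) / R.card * u * f D.card)) fun D _ => by ring, h1]
  have h2 : Icc 1 R.card ⊆ range (R.card + 1) := by
    intro a; simp only [mem_Icc, mem_range]; omega
  rw [← sum_subset h2]
  · refine sum_congr rfl fun a ha => ?_
    rw [mem_Icc] at ha
    obtain ⟨a, rfl⟩ := Nat.exists_eq_add_of_le' ha.1
    obtain ⟨r, hr'⟩ := Nat.exists_eq_add_of_le' hr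
    rw [hr'] at hr0 ⊢
    have h3 : ((r : ℝ) + 1) * (r.choose a : ℝ) = ((r + 1).choose (a + 1) : ℝ) * ((a : ℝ) + 1) := by
      exact_mod_cast Nat.add_one_mul_choose_eq r a
    have h4 : ((r + 1).choose (a + 1) : ℝ) * (((a + 1 : ℕ) : ℝ) / ((r + 1 : ℕ) : ℝ)) =
        (r.choose a : ℝ) := by
      push_cast at hr0 ⊢
      field_simp
      linarith
    simp only [Nat.add_sub_cancel]
    rw [← h4, pow_succ]
    field_simp
  · intro a ha ha'
    have : a = 0 := by
      simp only [mem_Icc, mem_range] at ha ha'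
      omega
    simp [this]

lemma sum_powerset_ripple_eq_one {u : ℕ} (hu : 1 ≤ u) {R : Finset (Fin m)} (hR : R.Nonempty) :
    ∑ D ∈ R.powerset, ((D.card : ℝ) / R.card * u * subsetWeight (1 / (u : ℝ)) R D) = 1 := by
  have h := sum_powerset_ripple hu hR fun _ => 1
  simp only [mul_one] at h
  have hr : 0 < R.card := card_pos.2 hR
  obtain ⟨r, hr'⟩ := Nat.exists_eq_add_of_le' hr
  rw [h, hr', ← Ico_add_one_right_eq_Icc, sum_Ico_eq_sum_range]
  have h2 := add_pow (1 / (u : ℝ)) (1 - 1 / (u : ℝ)) r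
  rw [add_sub_cancel, one_pow] at h2
  refine Eq.trans (sum_congr (by simp) fun a _ => ?_) h2.symm
  have e1 : 1 + a - 1 = a := by omega
  have e2 : r + 1 - (1 + a) = r - a := by omega
  rw [e1, e2]
  simp only [Nat.add_sub_cancel]
  ring

/-- A given cloud symbol falls into the ripple with probability `p`. -/
lemma sum_powerset_subsetWeight_mem (p : ℝ) {C : Finset (Fin m)} {i : Fin m} (hi : i ∈ C) :
    ∑ B ∈ C.powerset, subsetWeight p C B * (if i ∈ B then 1 else 0) = p := by
  have h := prod_add (fun _ => p) (fun j => if j = i then 0 else 1 - p) C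
  have hl : ∏ j ∈ C, (p + if j = i then 0 else 1 - p) = p := by
    rw [prod_eq_single_of_mem i hi]
    · simp
    · intro j _ hj
      simp [hj]
  refine Eq.trans (sum_congr rfl fun B hB => ?_) (h.symm.trans hl)
  rw [prod_const, subsetWeight]
  split_ifs with hiB
  · rw [prod_congr rfl (g := fun _ => 1 - p), prod_const, mul_one]
    intro j hj
    rw [if_neg]
    rintro rfl
    exact (mem_sdiff.1 hj).2 hiB
  · have h0 : ∏ j ∈ C \ B, (if j = i then 0 else 1 - p) = 0 :=
      prod_eq_zero (mem_sdiff.2 ⟨hi, hiB⟩) (if_pos rfl)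
    rw [h0, mul_zero, mul_zero]

lemma kernelExpect_mem_ripple (p : ℝ) {u : ℕ} (hu : 1 ≤ u) {C R : Finset (Fin m)} (n : ℕ)
    (hCR : Disjoint C R) {i : Fin m} (hi : i ∈ C) :
    kernelExpect p u C R n (fun _ R _ => if i ∈ R then 1 else 0) = p := by
  have hiR := disjoint_left.1 hCR hi
  unfold kernelExpect
  split_ifs with hR
  · simp only [mem_union, mem_sdiff, hiR, false_and, false_or]
    refine Eq.trans (sum_congr rfl fun B _ => ?_) (sum_powerset_subsetWeight_mem p hi)
    rw [← sum_mul, ← mul_sum, sum_powerset_ripple_eq_one hu hR, mul_one]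
  · exact sum_powerset_subsetWeight_mem p hi

lemma kernelExpect_card (p : ℝ) {u : ℕ} (hu : 1 ≤ u) {C R : Finset (Fin m)} (n : ℕ)
    (hCR : Disjoint C R) (s' : ℕ × ℕ × ℕ) :
    kernelExpect p u C R n (fun C R n => if (C.card, R.card, n) = s' then 1 else 0) =
      transProb p u (C.card, R.card, n) s' := by
  unfold kernelExpect transProb
  dsimp only
  by_cases hR : R.Nonempty
  · rw [if_pos hR, if_pos (card_pos.2 hR)]
    have h1 : ∀ B ∈ C.powerset, ∑ D ∈ R.powerset, subsetWeight p C B *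
        ((D.card : ℝ) / R.card * u * subsetWeight (1 / (u : ℝ)) R D) *
          (if ((C \ B).card, ((R \ D) ∪ B).card, n) = s' then 1 else 0) =
        subsetWeight p C B * ∑ a ∈ Icc 1 R.card, ((R.card - 1).choose (a - 1) : ℝ) *
          (1 / (u : ℝ)) ^ (a - 1) * (1 - 1 / (u : ℝ)) ^ (R.card - a) *
            (if s' = (C.card - B.card, R.card - a + B.card, n) then 1 else 0) := by
      intro B hB
      rw [mem_powerset] at hB
      rw [← sum_powerset_ripple hu hR
        (fun a => if s' = (C.card - B.card, R.card - a + B.card, n) then 1 else 0), mul_sum]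
      refine sum_congr rfl fun D hD => ?_
      rw [mem_powerset] at hD
      have hd : Disjoint (R \ D) B :=
        disjoint_of_subset_left sdiff_subset (disjoint_of_subset_right hB hCR.symm)
      rw [card_union_of_disjoint hd, card_sdiff_of_subset hB, card_sdiff_of_subset hD, mul_assoc]
      simp only [eq_comm (b := s')]
    rw [sum_congr rfl h1, sum_powerset_subsetWeight p C fun b => ∑ a ∈ Icc 1 R.card,
      ((R.card - 1).choose (a - 1) : ℝ) * (1 / (u : ℝ)) ^ (a - 1) *
        (1 - 1 / (u : ℝ)) ^ (R.card - a) *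
          (if s' = (C.card - b, R.card - a + b, n) then 1 else 0)]
    refine sum_congr rfl fun b _ => ?_
    rw [mul_sum]
    refine sum_congr rfl fun a _ => ?_
    split_ifs <;> ring
  · rw [if_neg hR, if_neg (by simpa [card_pos] using hR)]
    have h1 : ∀ B ∈ C.powerset, subsetWeight p C B *
          (if ((C \ B).card, B.card, n + 1) = s' then (1 : ℝ) else 0) =
        subsetWeight p C B *
          (fun b => if s' = (C.card - b, b, n + 1) then (1 : ℝ) else 0) B.card := by
      intro B hB
      rw [card_sdiff_of_subset (mem_powerset.1 hB)]
      simp only [eq_comm (b := s')]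
    rw [sum_congr rfl h1,
      sum_powerset_subsetWeight p C fun b => if s' = (C.card - b, b, n + 1) then (1 : ℝ) else 0]
    refine sum_congr rfl fun b _ => ?_
    rw [mul_ite, mul_one, mul_zero]

/-! ### The laws of the decoder state -/

instance (Ω : PMF ℕ) (k m : ℕ) : MeasureTheory.IsProbabilityMeasure (Pr Ω k m) := by
  unfold Pr
  infer_instance

lemma cond_real_eq_of_real_inter {Ω : PMF ℕ} {E E' : Set (Run k m)} {c : ℝ}
    (hE : Pr Ω k m E ≠ 0) (h : (Pr Ω k m).real (E ∩ E') = c * (Pr Ω k m).real E) :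
    (ProbabilityTheory.cond (Pr Ω k m) E).real E' = c := by
  have h0 : (Pr Ω k m).real E ≠ 0 := by
    rw [MeasureTheory.measureReal_def, ENNReal.toReal_ne_zero]
    exact ⟨hE, MeasureTheory.measure_ne_top _ _⟩
  rw [MeasureTheory.measureReal_def, ProbabilityTheory.cond_apply MeasurableSpace.measurableSet_top,
    ENNReal.toReal_mul, ENNReal.toReal_inv, ← MeasureTheory.measureReal_def,
    ← MeasureTheory.measureReal_def, h]
  field_simp

lemma Pr_real_mem_ripple {Ω : PMF ℕ} {dmax : ℕ} (hdmax : dmax ≤ k)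
    (hΩ : ∀ d, Ω d ≠ 0 → 1 ≤ d ∧ d ≤ dmax) {u : ℕ} (hu : 1 ≤ u) (huk : u ≤ k) (i : Fin m) :
    (Pr Ω k m).real ({ω | i ∈ cloudAt u ω} ∩ {ω | i ∈ rippleAt (u - 1) ω}) =
      leaveProb Ω k dmax u * (Pr Ω k m).real {ω | i ∈ cloudAt u ω} :=
  Pr_real_and_eq_mul hdmax hΩ hu huk (fun C _ _ => i ∈ C) (fun _ R _ => i ∈ R) _
    fun _ _ n hCR hi => kernelExpect_mem_ripple _ hu n hCR hi

lemma Pr_real_transition {Ω : PMF ℕ} {dmax : ℕ} (hdmax : dmax ≤ k)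
    (hΩ : ∀ d, Ω d ≠ 0 → 1 ≤ d ∧ d ≤ dmax) {u : ℕ} (hu : 1 ≤ u) (huk : u ≤ k)
    (s s' : ℕ × ℕ × ℕ) :
    (Pr Ω k m).real ({ω | S u ω = s} ∩ {ω | S (u - 1) ω = s'}) =
      transProb (leaveProb Ω k dmax u) u s s' * (Pr Ω k m).real {ω | S u ω = s} := by
  refine Pr_real_and_eq_mul hdmax hΩ hu huk (fun C R n => (C.card, R.card, n) = s)
    (fun C R n => (C.card, R.card, n) = s') _ ?_
  rintro C R n hCR rfl
  exact kernelExpect_card _ hu n hCR s'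

lemma Pr_real_eq_sum_S (Ω : PMF ℕ) (u : ℕ) (E : Set (Run k m)) :
    (Pr Ω k m).real E = ∑ c ∈ range (m + 1), ∑ r ∈ range (m + 1), ∑ n ∈ range (k + 1),
      (Pr Ω k m).real ({ω | S u ω = (c, r, n)} ∩ E) := by
  -- the states met at stage `u` form a finite box, whatever the run
  have hcover : E = ⋃ s ∈ range (m + 1) ×ˢ range (m + 1) ×ˢ range (k + 1),
      ({ω | S u ω = s} ∩ E) := by
    ext ω
    simp only [Set.mem_iUnion, Set.mem_inter_iff, Set.mem_ofPred_eq, exists_prop]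
    refine ⟨fun h => ⟨S u ω, ?_, rfl, h⟩, fun ⟨_, _, _, h⟩ => h⟩
    simp only [S, mem_product, mem_range, Nat.lt_succ_iff]
    have hle : ∀ {n : ℕ} (T : Finset (Fin n)), T.card ≤ n := fun T => by
      simpa using card_le_univ T
    exact ⟨hle _, hle _, hle _⟩
  conv_lhs => rw [hcover]
  rw [MeasureTheory.measureReal_biUnion_finset]
  · simp only [sum_product]
  · intro s _ s' _ hne
    rw [Function.onFun, Set.disjoint_left]
    rintro ω ⟨h, -⟩ ⟨h', -⟩
    exact hne (h.symm.trans h')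
  · exact fun _ _ => MeasurableSpace.measurableSet_top

/-- At the start, every output symbol is in the ripple independently with probability `Ω 1`, and in
the cloud otherwise. -/
lemma Pr_real_S_initial {Ω : PMF ℕ} {dmax : ℕ} (hdmax : dmax ≤ k)
    (hΩ : ∀ d, Ω d ≠ 0 → 1 ≤ d ∧ d ≤ dmax) (c r n : ℕ) :
    (Pr Ω k m).real {ω | S k ω = (c, r, n)} =
      if c + r = m ∧ n = 0 then
        (m.choose r : ℝ) * (Ω 1).toReal ^ r * (1 - (Ω 1).toReal) ^ c else 0 := by
  have hk : ∀ d, Ω d ≠ 0 → d ≤ k := fun d h => (hΩ d h).2.trans hdmax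
  obtain ⟨d, hd⟩ := Ω.support_nonempty
  have hk1 : 1 ≤ k := (hΩ d hd).1.trans (hk d hd)
  have e := Pr_real_eq_expect (m := m) Ω hk1 le_rfl (fun G x _ =>
    ((cloud G x.active).card, (ripple G x.active).card, x.inactive.card) = (c, r, n))
  refine e.trans ?_
  simp only [Nat.sub_self, chain, expect_pure, expect_const, card_empty]
  -- almost surely no output symbol has degree zero
  have hcloud : ∀ G : Fin m → Finset (Fin k), graphLaw Ω k m G ≠ 0 →
      (cloud G univ).card + (ripple G univ).card = m := by
    intro G hG
    rw [← card_union_of_disjoint (disjoint_cloud_ripple G univ)]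
    convert card_fin m
    rw [eq_univ_iff_forall]
    intro i
    have h1 : (neighborhoodLaw Ω k (G i)).toReal ≠ 0 := by
      have : (graphLaw Ω k m G).toReal ≠ 0 :=
        ENNReal.toReal_ne_zero.2 ⟨hG, PMF.apply_ne_top _ _⟩
      rw [graphLaw_toReal] at this
      exact prod_ne_zero_iff.1 this i (mem_univ i)
    rw [neighborhoodLaw_toReal hk] at h1
    have h2 : Ω (G i).card ≠ 0 := fun h => h1 (by simp [h])
    have := (hΩ _ h2).1
    simp only [cloud, ripple, mem_union, mem_filter, mem_univ, true_and, inter_univ]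
    omega
  split_ifs with hc
  · obtain ⟨hcr, rfl⟩ := hc
    rw [expect_congr_of_ne_zero _ (g := fun G => if (ripple G univ).card = r then 1 else 0)]
    swap
    · intro G hG
      have := hcloud G hG
      congr 1
      simp only [Prod.mk.injEq, and_true, eq_iff_iff]
      omega
    have hone : ∑ S with S.card = 1, (neighborhoodLaw Ω k S).toReal = (Ω 1).toReal := by
      have h := sum_neighborhoodLaw_filter hdmax hΩ (fun S => S.card = 1)
      rw [h]
      by_cases h1 : 1 ∈ Icc 1 dmax
      · rw [sum_eq_single_of_mem 1 h1]
        · have hf : (powersetCard 1 (univ : Finset (Fin k))).filter (fun S => S.card = 1) =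
              powersetCard 1 univ := filter_true_of_mem fun S hS => (mem_powersetCard.1 hS).2
          have : (k.choose 1 : ℝ) ≠ 0 := by
            rw [Nat.choose_one_right]; positivity
          rw [hf, card_powersetCard, card_fin, div_mul_cancel₀ _ this]
        · intro d _ hne
          have hf : (powersetCard d (univ : Finset (Fin k))).filter (fun S => S.card = 1) = ∅ :=
            filter_false_of_mem fun S hS h => hne ((mem_powersetCard.1 hS).2.symm.trans h)
          rw [hf]
          simp
      · have h0 : Ω 1 = 0 := by
          by_contra hne
          exact h1 (mem_Icc.2 (hΩ 1 hne))
        rw [h0, ENNReal.toReal_zero]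
        refine sum_eq_zero fun d hd => ?_
        rw [mem_Icc] at h1 hd
        omega
    have hR : ∀ R : Finset (Fin m), ∑ G : Fin m → Finset (Fin k),
        (graphLaw Ω k m G).toReal * (if ripple G univ = R then 1 else 0) =
          subsetWeight (Ω 1).toReal univ R := by
      intro R
      rw [← prod_ite_eq_subsetWeight _ (subset_univ R)]
      have h1 : ∀ i : Fin m, ∑ S : Finset (Fin k), (neighborhoodLaw Ω k S).toReal *
          (if (S.card = 1 ↔ i ∈ R) then 1 else 0) =
            if i ∈ univ then (if i ∈ R then (Ω 1).toReal else 1 - (Ω 1).toReal) else 1 := by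
        intro i
        rw [sum_mul_ite_iff _ _ _ _ (c := (Ω 1).toReal), sum_neighborhoodLaw]
        · simp
        · rw [sum_neighborhoodLaw, ← hone, sum_filter]
          simp
      rw [prod_congr rfl fun i _ => (h1 i).symm, prod_univ_sum, Fintype.piFinset_univ]
      refine sum_congr rfl fun G _ => ?_
      rw [prod_mul_distrib, graphLaw_toReal]
      congr 1
      have h2 := prod_ite_iff_eq (subset_univ R) (subset_univ (ripple G univ))
        (fun i => (G i).card = 1) (by simp [ripple])
      simp only [mem_univ, if_true] at h2
      exact h2.symm
    unfold expect
    rw [sum_congr rfl (g := fun G => ∑ R ∈ powersetCard r univ,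
      (graphLaw Ω k m G).toReal * (if ripple G univ = R then 1 else 0)), sum_comm]
    · rw [sum_congr rfl fun R _ => hR R, sum_congr rfl
        (g := fun _ => (Ω 1).toReal ^ r * (1 - (Ω 1).toReal) ^ c), sum_const, card_powersetCard,
        card_fin, nsmul_eq_mul, mul_assoc]
      intro R hR
      have hRr := (mem_powersetCard.1 hR).2
      rw [subsetWeight, card_sdiff_of_subset (subset_univ R), hRr, card_fin]
      congr 2
      omega
    · intro G _
      rw [← mul_sum, sum_ite_eq]
      simp
  · rw [expect_congr_of_ne_zero _ (g := fun _ => 0)]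
    · simp [expect]
    · intro G hG
      have := hcloud G hG
      refine if_neg fun h => hc ?_
      simp only [Prod.mk.injEq] at h
      omega

/-- Almost surely, the inactivations are counted by the inactive symbols at the end. -/
lemma ae_N_eq (Ω : PMF ℕ) (k m : ℕ) :
    ∀ᵐ ω ∂(Pr Ω k m), N ω = (ω.marks 0).inactive.card := by
  rw [MeasureTheory.ae_iff, Pr, PMF.toMeasure_apply_eq_zero_iff _ MeasurableSpace.measurableSet_top,
    Set.disjoint_left]
  intro ω hω
  simp only [PMF.mem_support_bind_iff, PMF.mem_support_map_iff] at hω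
  obtain ⟨G, -, x, hx, rfl⟩ := hω
  have := (mem_support_history G le_rfl x hx).2.2
  rw [Nat.sub_self, zero_add] at this
  simp only [N, rippleAt, Set.mem_ofPred_eq, not_not]
  refine Eq.trans (congrArg card (filter_congr fun u _ => ?_)) this
  rfl

lemma Pr_real_N (Ω : PMF ℕ) (n : ℕ) :
    (Pr Ω k m).real {ω | N ω = n} = ∑ c₀ ∈ range (m + 1), ∑ r₀ ∈ range (m + 1),
      (Pr Ω k m).real {ω | S 0 ω = (c₀, r₀, n)} := by
  have h1 : (Pr Ω k m).real {ω | N ω = n} =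
      (Pr Ω k m).real {ω | (ω.marks 0).inactive.card = n} := by
    refine MeasureTheory.measureReal_congr (Filter.eventuallyEq_set.2 ?_)
    filter_upwards [ae_N_eq Ω k m] with ω hω
    rw [hω]
  rw [h1, Pr_real_eq_sum_S Ω 0]
  refine sum_congr rfl fun c _ => sum_congr rfl fun r _ => ?_
  have h2 : ∀ j, j ≠ n →
      {ω : Run k m | S 0 ω = (c, r, j)} ∩ {ω | (ω.marks 0).inactive.card = n} = ∅ := by
    intro j hj
    ext ω
    simp only [S, Set.mem_inter_iff, Set.mem_ofPred_eq, Prod.mk.injEq, Set.mem_empty_iff_false,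
      iff_false]
    rintro ⟨⟨-, -, h⟩, h'⟩
    exact hj (h.symm.trans h')
  have h3 : {ω : Run k m | S 0 ω = (c, r, n)} ∩ {ω | (ω.marks 0).inactive.card = n} =
      {ω | S 0 ω = (c, r, n)} := by
    refine Set.inter_eq_left.2 fun ω h => ?_
    simp only [S, Set.mem_ofPred_eq, Prod.mk.injEq] at h
    exact h.2.2
  rw [sum_eq_single n (fun j _ hj => by rw [h2 j hj, MeasureTheory.measureReal_empty]), h3]
  intro hn
  have h4 : {ω : Run k m | S 0 ω = (c, r, n)} = ∅ := by
    ext ω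
    simp only [S, Set.mem_ofPred_eq, Prod.mk.injEq, Set.mem_empty_iff_false, iff_false]
    rintro ⟨-, -, h⟩
    refine hn (mem_range.2 (Nat.lt_succ_of_le ?_))
    rw [← h]
    simpa using card_le_univ (ω.marks 0).inactive
  rw [h3, h4, MeasureTheory.measureReal_empty]

end LTCode

theorem mainTheorem4 (k m dmax : ℕ) (Ω : PMF ℕ) (hdmax : dmax ≤ k)
    (hΩ : ∀ d, Ω d ≠ 0 → 1 ≤ d ∧ d ≤ dmax) :
    -- the parameter `p_u` is the conditional probability that a cloud symbol enters the ripple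
    (∀ u, 1 ≤ u → u ≤ k → ∀ i : Fin m,
      LTCode.Pr Ω k m {ω | i ∈ LTCode.cloudAt u ω} ≠ 0 →
      (ProbabilityTheory.cond (LTCode.Pr Ω k m) {ω | i ∈ LTCode.cloudAt u ω}).real
          {ω | i ∈ LTCode.rippleAt (u - 1) ω} = LTCode.leaveProb Ω k dmax u) ∧
    -- the initial condition
    (∀ c r n : ℕ, (LTCode.Pr Ω k m).real {ω | LTCode.S k ω = (c, r, n)} =
      if c + r = m ∧ n = 0 then
        (m.choose r : ℝ) * (Ω 1).toReal ^ r * (1 - (Ω 1).toReal) ^ c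
      else 0) ∧
    -- the transition probabilities
    (∀ u, 1 ≤ u → u ≤ k → ∀ s s' : ℕ × ℕ × ℕ,
      LTCode.Pr Ω k m {ω | LTCode.S u ω = s} ≠ 0 →
      (ProbabilityTheory.cond (LTCode.Pr Ω k m) {ω | LTCode.S u ω = s}).real
          {ω | LTCode.S (u - 1) ω = s'} =
        LTCode.transProb (LTCode.leaveProb Ω k dmax u) u s s') ∧
    -- the recursion for the state distribution
    (∀ u, 1 ≤ u → u ≤ k → ∀ s' : ℕ × ℕ × ℕ,
      (LTCode.Pr Ω k m).real {ω | LTCode.S (u - 1) ω = s'} =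
        ∑ c ∈ Finset.range (m + 1), ∑ r ∈ Finset.range (m + 1), ∑ n ∈ Finset.range (k + 1),
          (LTCode.Pr Ω k m).real {ω | LTCode.S u ω = (c, r, n)} *
            LTCode.transProb (LTCode.leaveProb Ω k dmax u) u (c, r, n) s') ∧
    -- the distribution of the number of inactivations
    (∀ n : ℕ, (LTCode.Pr Ω k m).real {ω | LTCode.N ω = n} =
      ∑ c₀ ∈ Finset.range (m + 1), ∑ r₀ ∈ Finset.range (m + 1),
        (LTCode.Pr Ω k m).real {ω | LTCode.S 0 ω = (c₀, r₀, n)}) := by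
  refine ⟨fun u hu huk i hi => ?_, LTCode.Pr_real_S_initial hdmax hΩ,
    fun u hu huk s s' hs => ?_, fun u hu huk s' => ?_, LTCode.Pr_real_N Ω⟩
  · exact LTCode.cond_real_eq_of_real_inter hi (LTCode.Pr_real_mem_ripple hdmax hΩ hu huk i)
  · exact LTCode.cond_real_eq_of_real_inter hs (LTCode.Pr_real_transition hdmax hΩ hu huk s s')
  · rw [LTCode.Pr_real_eq_sum_S Ω u]
    simp only [LTCode.Pr_real_transition hdmax hΩ hu huk, mul_comm]
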